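/- For $N\ge 1$ consider the Gaussian ensemble of complex $N\times(N+1)$ matrices $B$ with density proportional to $e^{-N\operatorname{tr}BB^\dagger}$ with respect to Lebesgue measure $\prod_{i,j}d\,\mathrm{Re}\,B_{ij}\,d\,\mathrm{Im}\,B_{ij}$ (the generalized Laguerre ensemble with $\gamma_1N=N$, $\gamma_2N=N+1$), and its one-loop mean $$W_1(x)=\frac1N\Bigl\langle \operatorname{tr}\frac1{x-BB^\dagger}\Bigr\rangle ,\qquad x\in\mathbb C\setminus[0,\infty).$$ Then $W_1$ has a unique expansion $$W_1(x)=\sum_{r=0,\frac12,1,\frac32,\dots}N^{-2r}W_1^{(r)}(x),\qquad W_1^{(r)}(x)=\sum_{n=0}^\infty C_n^{(r)}x^{-1-n-2r},$$ with real coefficients $C_n^{(r)}$ that do not depend on $N$, in the following sense: for each fixed $N\ge1$ the double series, ordered by powers of $1/x$ (the coefficient of $x^{-1-p}$ being the finite sum $\sum_{j=0}^{p}N^{-j}C^{(j/2)}_{p-j}$), is the asymptotic expansion of $W_1(x)$ as $x\to\infty$ in every sector $\{x:\operatorname{dist}(x,[0,\infty))\ge\delta|x|\}$, $\delta>0$.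 Put $C_n^{(r)}=0$ whenever $r<0$ or $n<0$. Then for all $n\in\mathbb Z$ and all $r\in\frac12\mathbb Z$, $$\begin{aligned} &(n+1)\bigl(2C^{(r)}_{n-2r}+C^{(r-1/2)}_{n-2r+1}\bigr)-4(2n-1)\bigl(C^{(r)}_{n-2r-1}+C^{(r-1/2)}_{n-2r}\bigr)\\ &-(n-1)(n-2)(n-3)\bigl(2C^{(r-1)}_{n-2r}+C^{(r-3/2)}_{n-2r+1}\bigr)-(n+1)(n-1)C^{(r-1)}_{n-2r+1}\\ &+(n-1)(n-2)(n-3)^2C^{(r-2)}_{n-2r+1} =2\delta_{r,0}\delta_{n,0}+\delta_{r,1/2}\delta_{n,0}+2\delta_{r,1/2}\delta_{n,1}+2\delta_{r,1}\delta_{n,1}. \end{aligned}$$ -/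

import Mathlib

open scoped Filter
open Asymptotics

noncomputable section

namespace GenLaguerre

/-- The average `(1/Z) ∫ DB DB† e^{-N tr BB†} F(B)` over rectangular complex `N × M` matrices, with
respect to Lebesgue measure `∏ d Re B_{ij} d Im B_{ij}`, where `Z = ∫ DB DB† e^{-N tr BB†}`. -/
def average (N M : ℕ) (F : Matrix (Fin N) (Fin M) ℂ → ℂ) : ℂ :=
  (∫ b : Fin N → Fin M → ℂ,
      (Real.exp (-(N : ℝ) *
        (Matrix.trace (Matrix.of b * (Matrix.of b).conjTranspose)).re) : ℂ) * F (Matrix.of b)) /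
    (∫ b : Fin N → Fin M → ℂ,
      (Real.exp (-(N : ℝ) *
        (Matrix.trace (Matrix.of b * (Matrix.of b).conjTranspose)).re) : ℂ))

/-- The one-loop mean `W₁(x) = N⁻¹ ⟨tr (x - BB†)⁻¹⟩` of the `N × (N+1)` ensemble, normalized so that
its expansion at infinity starts with `1/x`. -/
def W₁ (N : ℕ) (x : ℂ) : ℂ :=
  (N : ℂ)⁻¹ * average N (N + 1) fun B =>
    Matrix.trace ((Matrix.scalar (Fin N) x - B * B.conjTranspose)⁻¹)

/-- The coefficient of `x^{-1-p}` in the double series `∑_j N^{-j} ∑_n C j n x^{-1-n-j}`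
(`j, n ≥ 0`). Here `C j n` stands for `C_n^{(r)}` with `r = j/2`, so that `j = 2r`. -/
def doubleSeriesCoeff (C : ℤ → ℤ → ℝ) (N p : ℕ) : ℝ :=
  ∑ j ∈ Finset.range (p + 1), C j ((p : ℤ) - j) / (N : ℝ) ^ j

/-- A nontangential region around infinity in `ℂ \ [0,∞)`: the closed sector of the points whose
distance to the half-line `[0,∞)` is at least `δ |x|`. -/
def sector (δ : ℝ) : Set ℂ :=
  {x | ∀ t : ℝ, 0 ≤ t → δ * ‖x‖ ≤ ‖x - t‖}

/-- `C j n = C_n^{(j/2)}` are the coefficients of the fractional-genus expansion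
`W₁(x) = ∑_r N^{-2r} W₁^{(r)}(x)`, `W₁^{(r)}(x) = ∑_n C_n^{(r)} x^{-1-n-2r}`, `r = 0, 1/2, 1, …`,
extended by zero to negative indices: for every `N ≥ 1` the double series, ordered by powers of
`1/x`, is the asymptotic expansion of `W₁(x)` as `x → ∞` away from the half-line `[0,∞)`. -/
def IsFractionalGenusExpansion (C : ℤ → ℤ → ℝ) : Prop :=
  (∀ j n : ℤ, j < 0 ∨ n < 0 → C j n = 0) ∧
    ∀ N : ℕ, 1 ≤ N → ∀ δ : ℝ, 0 < δ → ∀ P : ℕ,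
      (fun x : ℂ => W₁ N x -
          ∑ p ∈ Finset.range P, (doubleSeriesCoeff C N p : ℂ) / x ^ (p + 1))
        =O[Bornology.cobounded ℂ ⊓ 𝓟 (sector δ)] fun x : ℂ => 1 / x ^ (P + 1)

end GenLaguerre

end

/-!
Expand `tr (B B†)^k` in hook Schur functions, up to signs. Gaussian integration by parts shows that
the expectation of each hook function is a product over the arm and the leg of the hook, so that
the moments `E tr (B B†)^k` are explicit hypergeometric sums, polynomial in the two matrix sizes.
Two first-order contiguity relations between such sums combine into the three-term recurrence of
Haagerup and Thorbjørnsen for the moments. Expanding the resolvent away from `[0, ∞)` identifies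
the expansion of `W₁` at infinity: the coefficient of `x^{-1-p}` is a polynomial `q_p` in `1/N`
of degree at most `p`, and `C_n^{(r)}` is the coefficient of `N^{-2r}` in `q_{n+2r}`.

If `R_n` denotes the three-term recurrence of `q_n, q_{n-1}, q_{n-2}`, the recurrence of the theorem
is the coefficient of `N^{-2r}` in `(2 + 1/N) R_n - (n - 2) N^{-2} R_{n-1}`. The expansion is unique
because asymptotic coefficients are, and because a polynomial in `1/N` is determined by its values
at all `N ≥ 1`.
-/

noncomputable section

namespace GenLaguerre

open Matrix Finset

section TraceRecursion

variable {K : Type*} [Field K] {A : Type*} [CommRing A] [Algebra K A]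
  {n : Type*} [Fintype n] [DecidableEq n]

/-- The coefficients `P_l` of `x ^ l` in `det (1 - x W)^{-θ} (1 - x W)⁻¹`, generated by the
Faddeev–LeVerrier recursion `P_{l+1} = θ (l+1)⁻¹ tr (W P_l) + W P_l`. -/
def resolventCoeff (θ : K) (W : Matrix n n A) : ℕ → Matrix n n A
  | 0 => 1
  | l + 1 => ((θ / ((l : K) + 1)) • trace (W * resolventCoeff θ W l)) • 1
      + W * resolventCoeff θ W l

/-- The coefficients `h_l` of `x ^ l` in `det (1 - x W)^{-θ}`: for `θ = 1` the complete homogeneous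
and for `θ = -1` the signed elementary symmetric functions of the eigenvalues of `W`. -/
def detPowCoeff (θ : K) (W : Matrix n n A) : ℕ → A
  | 0 => 1
  | l + 1 => (θ / ((l : K) + 1)) • trace (W * resolventCoeff θ W l)

variable (θ : K) (W : Matrix n n A)

theorem resolventCoeff_zero : resolventCoeff θ W 0 = 1 := rfl

theorem detPowCoeff_zero : detPowCoeff θ W 0 = 1 := rfl

theorem resolventCoeff_succ (l : ℕ) : resolventCoeff θ W (l + 1) =
    detPowCoeff θ W (l + 1) • 1 + W * resolventCoeff θ W l := rfl

theorem commute_resolventCoeff {V W : Matrix n n A} (h : Commute V W) (l : ℕ) :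
    Commute V (resolventCoeff θ W l) := by
  induction l with
  | zero => exact Commute.one_right V
  | succ l ih => exact ((Commute.one_right V).smul_right _).add_right (h.mul_right ih)

theorem resolventCoeff_eq_sum (l : ℕ) : resolventCoeff θ W l =
    ∑ ij ∈ antidiagonal l, detPowCoeff θ W ij.1 • W ^ ij.2 := by
  induction l with
  | zero => simp [resolventCoeff_zero, detPowCoeff_zero]
  | succ l ih =>
    rw [resolventCoeff_succ, ih, Finset.Nat.sum_antidiagonal_succ', mul_sum, pow_zero]
    simp only [pow_succ', mul_smul_comm]

theorem trace_mul_resolventCoeff_eq_sum (l : ℕ) : trace (W * resolventCoeff θ W l) =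
    ∑ ij ∈ antidiagonal l, detPowCoeff θ W ij.1 * trace (W ^ (ij.2 + 1)) := by
  simp only [resolventCoeff_eq_sum, mul_sum, trace_sum, mul_smul_comm, trace_smul, pow_succ',
    smul_eq_mul]

theorem sum_trace_pow_smul_resolventCoeff (l : ℕ) :
    ∑ ij ∈ antidiagonal l, trace (W ^ (ij.2 + 1)) • resolventCoeff θ W ij.1 =
      ∑ ij ∈ antidiagonal l, trace (W * resolventCoeff θ W ij.1) • W ^ ij.2 := by
  induction l with
  | zero => simp [resolventCoeff_zero]
  | succ l ih =>
    have h := trace_mul_resolventCoeff_eq_sum θ W (l + 1)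
    rw [Finset.Nat.sum_antidiagonal_succ, detPowCoeff_zero, one_mul] at h
    rw [Finset.Nat.sum_antidiagonal_succ, Finset.Nat.sum_antidiagonal_succ', h]
    replace ih := congrArg (W * ·) ih
    simp only [mul_sum, mul_smul_comm, ← pow_succ'] at ih
    simp only [resolventCoeff_succ, resolventCoeff_zero, smul_add, sum_add_distrib, smul_smul,
      ← sum_smul, ih, pow_zero, add_smul, add_assoc, mul_comm]

section MulComm

variable {m : Type*} [Fintype m] [DecidableEq m] (b : Matrix n m A) (c : Matrix m n A)

variable {θ b c} in
theorem detPowCoeff_succ_mul_comm_of_mul_resolventCoeff {l : ℕ}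
    (h : c * resolventCoeff θ (b * c) l = resolventCoeff θ (c * b) l * c) :
    detPowCoeff θ (b * c) (l + 1) = detPowCoeff θ (c * b) (l + 1) := by
  rw [detPowCoeff, detPowCoeff, Matrix.mul_assoc b c, h, trace_mul_comm b, Matrix.mul_assoc,
    (commute_resolventCoeff θ (Commute.refl (c * b)) l).eq]

theorem mul_resolventCoeff_mul_comm (l : ℕ) :
    c * resolventCoeff θ (b * c) l = resolventCoeff θ (c * b) l * c := by
  induction l with
  | zero => simp [resolventCoeff_zero]
  | succ l ih =>
    rw [resolventCoeff_succ, resolventCoeff_succ,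
      detPowCoeff_succ_mul_comm_of_mul_resolventCoeff ih, Matrix.mul_add, Matrix.add_mul,
      Matrix.mul_smul, Matrix.smul_mul, Matrix.mul_one, Matrix.one_mul, Matrix.mul_assoc b, ih]
    simp only [Matrix.mul_assoc]

theorem detPowCoeff_mul_comm (l : ℕ) : detPowCoeff θ (b * c) l = detPowCoeff θ (c * b) l := by
  cases l with
  | zero => rfl
  | succ l =>
    exact detPowCoeff_succ_mul_comm_of_mul_resolventCoeff (mul_resolventCoeff_mul_comm θ b c l)

end MulComm

section CharZero

variable [CharZero K]

theorem natCast_succ_smul_detPowCoeff_succ (l : ℕ) :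
    ((l : K) + 1) • detPowCoeff θ W (l + 1) = θ • trace (W * resolventCoeff θ W l) := by
  rw [detPowCoeff, smul_smul, mul_div_cancel₀ _ (Nat.cast_add_one_ne_zero l)]

theorem natCast_smul_resolventCoeff_succ (l : ℕ) :
    ((l : K) + 2) • resolventCoeff θ W (l + 1) =
      ∑ ij ∈ antidiagonal (l + 1), ((ij.2 : K) + 1) • detPowCoeff θ W ij.1 • W ^ ij.2
      + θ • ∑ ij ∈ antidiagonal l, trace (W ^ (ij.2 + 1)) • resolventCoeff θ W ij.1 := by
  have split : ∀ ij ∈ antidiagonal (l + 1), ((l : K) + 2) • detPowCoeff θ W ij.1 • W ^ ij.2 =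
      ((ij.2 : K) + 1) • detPowCoeff θ W ij.1 • W ^ ij.2
        + (ij.1 : K) • detPowCoeff θ W ij.1 • W ^ ij.2 := by
    intro ij hij
    have h : (l : K) + 1 = ij.1 + ij.2 := by exact_mod_cast (mem_antidiagonal.1 hij).symm
    rw [← add_smul, show (l : K) + 2 = ij.2 + 1 + ij.1 by linear_combination h]
  rw [resolventCoeff_eq_sum, smul_sum, sum_congr rfl split, sum_add_distrib,
    sum_trace_pow_smul_resolventCoeff, Finset.Nat.sum_antidiagonal_succ (N := Matrix n n A)
      (f := fun ij => (ij.1 : K) • _)]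
  simp only [Nat.cast_zero, zero_smul, zero_add, Nat.cast_add, Nat.cast_one, ← smul_assoc,
    natCast_succ_smul_detPowCoeff_succ, smul_sum]

theorem trace_resolventCoeff (hθ : θ * θ = 1) (l : ℕ) :
    trace (resolventCoeff θ W l) = ((Fintype.card n : K) + θ * l) • detPowCoeff θ W l := by
  cases l with
  | zero => simp [resolventCoeff_zero, detPowCoeff_zero, Nat.cast_smul_eq_nsmul]
  | succ l =>
    have h := congrArg (θ • ·) (natCast_succ_smul_detPowCoeff_succ θ W l)
    simp only [smul_smul, hθ, one_smul] at h
    rw [resolventCoeff_succ, trace_add, trace_smul, trace_one, ← h, add_smul, smul_eq_mul,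
      mul_comm, Nat.cast_smul_eq_nsmul, nsmul_eq_mul, Nat.cast_succ]

end CharZero

variable (D : Derivation K A A)

theorem map_derivation_mul {l m k : Type*} [Fintype m] (X : Matrix l m A) (Y : Matrix m k A) :
    (X * Y).map D = X.map D * Y + X * Y.map D := by
  ext i j
  simp only [map_apply, mul_apply, Matrix.add_apply, map_sum, Derivation.leibniz, smul_eq_mul,
    ← sum_add_distrib]
  exact sum_congr rfl fun _ _ => by ring

theorem trace_mul_map_derivation_pow_succ {X : Matrix n n A} (h : Commute X W) (k : ℕ) :
    trace (X * (W ^ (k + 1)).map D) = (k + 1) * trace (X * W ^ k * W.map D) := by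
  induction k generalizing X with
  | zero => simp
  | succ k ih =>
    have hX : trace (X * ((W ^ (k + 1)).map D * W)) =
        (k + 1) * trace (X * W ^ (k + 1) * W.map D) := by
      rw [← mul_assoc, trace_mul_comm, ← mul_assoc, ih ((Commute.refl W).mul_left h), h.symm.eq,
        mul_assoc X, pow_succ']
    rw [pow_succ W (k + 1), map_derivation_mul, mul_add, trace_add, hX, mul_assoc X, Nat.cast_succ]
    ring

theorem derivation_trace_pow_succ (k : ℕ) :
    D (trace (W ^ (k + 1))) = (k + 1) * trace (W ^ k * W.map D) := by
  have h := trace_mul_map_derivation_pow_succ W D (Commute.one_left W) k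
  rw [one_mul, one_mul] at h
  rw [← h, trace, map_sum]
  rfl

theorem derivation_detPowCoeff_succ [CharZero K] (l : ℕ) :
    D (detPowCoeff θ W (l + 1)) = θ • trace (resolventCoeff θ W l * W.map D) := by
  induction l using Nat.strong_induction_on with
  | _ l ih =>
    suffices h : D (trace (W * resolventCoeff θ W l)) =
        ((l : K) + 1) • trace (resolventCoeff θ W l * W.map D) by
      rw [detPowCoeff, Derivation.map_smul, h, smul_smul,
        div_mul_cancel₀ _ (Nat.cast_add_one_ne_zero l)]
    have hh : ∑ ij ∈ antidiagonal l, detPowCoeff θ W ij.1 * D (trace (W ^ (ij.2 + 1))) =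
        trace ((∑ ij ∈ antidiagonal l, ((ij.2 : K) + 1) • detPowCoeff θ W ij.1 • W ^ ij.2)
          * W.map D) := by
      simp only [derivation_trace_pow_succ, sum_mul, trace_sum, smul_mul_assoc, trace_smul]
      refine sum_congr rfl fun _ _ => ?_
      rw [Algebra.smul_def, map_add, map_natCast, map_one, smul_eq_mul, mul_left_comm]
    simp only [trace_mul_resolventCoeff_eq_sum, map_sum, Derivation.leibniz, sum_add_distrib,
      smul_eq_mul, hh]
    cases l with
    | zero => simp [detPowCoeff_zero, resolventCoeff_zero]
    | succ l =>
      have ih' : ∀ ij ∈ antidiagonal l, trace (W ^ (ij.2 + 1)) * D (detPowCoeff θ W (ij.1 + 1)) =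
          θ • trace (trace (W ^ (ij.2 + 1)) • resolventCoeff θ W ij.1 * W.map D) := by
        intro ij hij
        rw [ih ij.1 (by have := mem_antidiagonal.1 hij; omega), smul_mul_assoc, trace_smul,
          mul_smul_comm, smul_eq_mul]
      have hD : ∑ ij ∈ antidiagonal (l + 1), trace (W ^ (ij.2 + 1)) * D (detPowCoeff θ W ij.1) =
          trace ((θ • ∑ ij ∈ antidiagonal l, trace (W ^ (ij.2 + 1)) • resolventCoeff θ W ij.1)
            * W.map D) := by
        rw [Finset.Nat.sum_antidiagonal_succ, detPowCoeff_zero, Derivation.map_one_eq_zero,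
          mul_zero, zero_add, sum_congr rfl ih', smul_mul_assoc, trace_smul, sum_mul, trace_sum,
          smul_sum]
      rw [hD, ← trace_add, ← add_mul, ← natCast_smul_resolventCoeff_succ, smul_mul_assoc,
        trace_smul, Nat.cast_succ, add_assoc, one_add_one_eq_two]

end TraceRecursion

section Divergence

variable {K : Type*} [Field K] {A : Type*} [CommRing A] [Algebra K A]
  {n m : Type*}

/-- The partially contracted divergence `(k, j) ↦ ∑ i, D_{ji} G_{ki}` of a matrix `G`, where the
derivation `D_{ji}` is thought of as the partial derivative in the `(j, i)` entry. -/
def matrixDiv [Fintype n] (D : m → n → Derivation K A A) (G : Matrix m n A) : Matrix m m A :=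
  of fun k j => ∑ i, D j i (G k i)

/-- The gradient `(i, j) ↦ D_{ji} f`, transposed so that it multiplies `m × n` matrices. -/
def matrixGrad (D : m → n → Derivation K A A) (f : A) : Matrix n m A :=
  of fun i j => D j i f

/-- The derivations `D_{ji}` act as the partial derivatives in the entries of `c`, the entries of
`b` being constants. This is the pairing of a complex matrix `b` with its adjoint `c`. -/
structure IsPartialDerivs [DecidableEq m] [DecidableEq n] (D : m → n → Derivation K A A)
    (b : Matrix n m A) (c : Matrix m n A) : Prop where
  apply_left (j : m) (i i' : n) (j' : m) : D j i (b i' j') = 0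
  apply_right (j : m) (i : n) (j' : m) (i' : n) :
    D j i (c j' i') = if j' = j ∧ i' = i then 1 else 0

theorem trace_mul_mul_mul_of_commute [Fintype n] [Fintype m] {b : Matrix n m A} {c : Matrix m n A}
    {X Y : Matrix n n A} (h : Commute (b * c) (X * Y)) :
    trace (c * X * (Y * b)) = trace (b * c * (X * Y)) := by
  rw [Matrix.mul_assoc, trace_mul_comm, ← Matrix.mul_assoc, Matrix.mul_assoc _ b, ← h.eq]

section Linearity

variable [Fintype n] (D : m → n → Derivation K A A)

theorem matrixDiv_add (G H : Matrix m n A) :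
    matrixDiv D (G + H) = matrixDiv D G + matrixDiv D H := by
  ext k j
  simp [matrixDiv, sum_add_distrib]

theorem matrixDiv_sub (G H : Matrix m n A) :
    matrixDiv D (G - H) = matrixDiv D G - matrixDiv D H := by
  ext k j
  simp [matrixDiv]

theorem matrixDiv_smul (f : A) (G : Matrix m n A) :
    matrixDiv D (f • G) = f • matrixDiv D G + G * matrixGrad D f := by
  ext k j
  simp [matrixDiv, matrixGrad, mul_apply, sum_add_distrib, mul_sum]

end Linearity

namespace IsPartialDerivs

variable [DecidableEq n] [DecidableEq m] {D : m → n → Derivation K A A} {b : Matrix n m A}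
  {c : Matrix m n A} (h : IsPartialDerivs D b c)

include h

theorem map_mul_left [Fintype m] (j : m) (i : n) :
    (b * c).map (D j i) = of fun k l => if l = i then b k j else 0 := by
  ext k l
  by_cases hl : l = i <;> simp [mul_apply, h.apply_left, h.apply_right, hl]

variable [Fintype n]

theorem matrixDiv_self : matrixDiv D c = (Fintype.card n : K) • (1 : Matrix m m A) := by
  ext k j
  by_cases hkj : k = j <;>
    simp [matrixDiv, h.apply_right, hkj, one_apply, Nat.cast_smul_eq_nsmul]

theorem map_mul_right (j : m) (i : n) :
    (c * b).map (D j i) = of fun k l => if k = j then b i l else 0 := by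
  ext k l
  simp [mul_apply, h.apply_left, h.apply_right, ite_and]

variable [Fintype m]

theorem matrixDiv_mul (G : Matrix m n A) :
    matrixDiv D (c * b * G) = trace (b * G) • 1 + c * b * matrixDiv D G := by
  have hD (j : m) (i : n) (k l : m) : D j i ((c * b) k l) = if k = j then b i l else 0 :=
    congrFun₂ (h.map_mul_right j i) k l
  ext k j
  simp only [matrixDiv, of_apply, Matrix.add_apply, Matrix.smul_apply, mul_apply (M := c * b),
    map_sum, Derivation.leibniz, hD, smul_eq_mul, sum_add_distrib, mul_sum]
  rw [add_comm, sum_comm (s := univ (α := n)) (t := univ (α := m)) (f := fun i l => _ * D j i _)]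
  congr 1
  by_cases hkj : k = j
  · subst hkj
    simp [trace, mul_apply, mul_comm]
  · simp [hkj]

variable [CharZero K] (θ : K)

theorem matrixGrad_detPowCoeff_succ (l : ℕ) :
    matrixGrad D (detPowCoeff θ (b * c) (l + 1)) = θ • (resolventCoeff θ (b * c) l * b) := by
  ext i j
  rw [matrixGrad, of_apply, derivation_detPowCoeff_succ, h.map_mul_left, Matrix.smul_apply]
  congr 1
  simp [trace, mul_apply]

theorem matrixDiv_mul_resolventCoeff (hθ : θ * θ = 1) (l : ℕ) :
    matrixDiv D (c * resolventCoeff θ (b * c) l) =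
      ((Fintype.card n : K) + θ * l) • resolventCoeff θ (c * b) l := by
  induction l with
  | zero => simp [resolventCoeff_zero, h.matrixDiv_self]
  | succ l ih =>
    have hsucc : c * resolventCoeff θ (b * c) (l + 1) = detPowCoeff θ (b * c) (l + 1) • c
        + c * b * (c * resolventCoeff θ (b * c) l) := by
      rw [resolventCoeff_succ, Matrix.mul_add, Matrix.mul_smul, Matrix.mul_one]
      simp only [Matrix.mul_assoc]
    have hgrad : c * matrixGrad D (detPowCoeff θ (b * c) (l + 1)) =
        θ • (c * b * resolventCoeff θ (c * b) l) := by
      rw [h.matrixGrad_detPowCoeff_succ, Matrix.mul_smul, ← Matrix.mul_assoc,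
        mul_resolventCoeff_mul_comm, Matrix.mul_assoc,
        (commute_resolventCoeff θ (Commute.refl (c * b)) l).eq]
    have htrace : trace (b * (c * resolventCoeff θ (b * c) l)) =
        algebraMap K A (θ * (l + 1)) * detPowCoeff θ (b * c) (l + 1) := by
      rw [← Matrix.mul_assoc, ← Algebra.smul_def, mul_smul, natCast_succ_smul_detPowCoeff_succ,
        smul_smul, hθ, one_smul]
    rw [hsucc, matrixDiv_add, matrixDiv_smul, h.matrixDiv_self, hgrad, h.matrixDiv_mul, ih, htrace,
      Matrix.mul_smul, resolventCoeff_succ, detPowCoeff_mul_comm]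
    push_cast
    module

end IsPartialDerivs

end Divergence

section Hook

variable (K : Type*) [Field K] {A : Type*} [CommRing A] [Algebra K A]
  {n : Type*} [Fintype n] [DecidableEq n]

/-- The hook functions `(k + l + 1)⁻¹ tr (W P_k Q_l)`, where `P` and `Q` are the coefficients of
`det (1 - x W)^{∓1} (1 - x W)⁻¹`. Up to the sign `(-1) ^ l` this is the Schur function of the
eigenvalues of `W` for the hook with arm length `k` and leg length `l`. -/
def hookTrace (W : Matrix n n A) (k l : ℕ) : A :=
  ((k : K) + l + 1)⁻¹ • trace (W * (resolventCoeff (1 : K) W k * resolventCoeff (-1 : K) W l))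

variable (W : Matrix n n A)

theorem resolventCoeff_mul_sub (k l : ℕ) :
    resolventCoeff (1 : K) W (k + 1) * resolventCoeff (-1 : K) W l
      - resolventCoeff (1 : K) W k * resolventCoeff (-1 : K) W (l + 1) =
    detPowCoeff (1 : K) W (k + 1) • resolventCoeff (-1 : K) W l
      - detPowCoeff (-1 : K) W (l + 1) • resolventCoeff (1 : K) W k := by
  rw [resolventCoeff_succ, resolventCoeff_succ, add_mul, mul_add, smul_mul_assoc, one_mul,
    mul_smul_comm, mul_one, (commute_resolventCoeff (1 : K) (Commute.refl W) k).eq, mul_assoc]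
  abel

theorem hookTrace_zero_right (k : ℕ) : hookTrace K W k 0 = detPowCoeff (1 : K) W (k + 1) := by
  simp [hookTrace, detPowCoeff, resolventCoeff_zero]

theorem hookTrace_zero_left (l : ℕ) :
    hookTrace K W 0 l = -detPowCoeff (-1 : K) W (l + 1) := by
  simp [hookTrace, detPowCoeff, resolventCoeff_zero, neg_div]

variable [CharZero K]

theorem natCast_smul_hookTrace (k l : ℕ) :
    ((k : K) + l + 1) • hookTrace K W k l =
      trace (W * (resolventCoeff (1 : K) W k * resolventCoeff (-1 : K) W l)) := by
  have h : (k : K) + l + 1 ≠ 0 := by exact_mod_cast Nat.succ_ne_zero (k + l)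
  rw [hookTrace, smul_smul, mul_inv_cancel₀ h, one_smul]

theorem detPowCoeff_mul_detPowCoeff (k l : ℕ) :
    detPowCoeff (1 : K) W (k + 1) * detPowCoeff (-1 : K) W (l + 1) =
      hookTrace K W k (l + 1) - hookTrace K W (k + 1) l := by
  have h : (k : K) + l + 2 ≠ 0 := by exact_mod_cast Nat.succ_ne_zero (k + l + 1)
  have hP := natCast_succ_smul_detPowCoeff_succ (1 : K) W k
  have hQ := natCast_succ_smul_detPowCoeff_succ (-1 : K) W l
  have hl := natCast_smul_hookTrace K W k (l + 1)
  have hk := natCast_smul_hookTrace K W (k + 1) l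
  have htr := congrArg (fun X => trace (W * X)) (resolventCoeff_mul_sub K W k l)
  simp only [mul_sub, trace_sub, mul_smul_comm, trace_smul, smul_eq_mul, ← hl, ← hk] at htr
  rw [one_smul] at hP
  rw [neg_smul, one_smul, ← neg_eq_iff_eq_neg] at hQ
  rw [← hP, ← hQ] at htr
  refine (isUnit_iff_ne_zero.2 h).smul_left_cancel.1 ?_
  simp only [Algebra.smul_def, map_add, map_natCast, map_ofNat, map_one, Nat.cast_succ] at htr ⊢
  linear_combination htr

theorem sum_detPowCoeff_mul_detPowCoeff (k : ℕ) :
    ∑ ij ∈ antidiagonal (k + 1), detPowCoeff (1 : K) W ij.1 * detPowCoeff (-1 : K) W ij.2 = 0 := by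
  cases k with
  | zero => simp [Finset.Nat.sum_antidiagonal_succ, detPowCoeff, resolventCoeff_zero]
  | succ k =>
    have hleft := Finset.Nat.sum_antidiagonal_succ (n := k)
      (f := fun ij => hookTrace K W ij.1 ij.2)
    have hright := Finset.Nat.sum_antidiagonal_succ' (n := k)
      (f := fun ij => hookTrace K W ij.1 ij.2)
    rw [hookTrace_zero_left] at hleft
    rw [hookTrace_zero_right] at hright
    rw [Finset.Nat.sum_antidiagonal_succ, Finset.Nat.sum_antidiagonal_succ']
    simp only [detPowCoeff_mul_detPowCoeff, sum_sub_distrib, detPowCoeff_zero, mul_one, one_mul]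
    linear_combination hleft - hright

theorem sum_detPowCoeff_smul_resolventCoeff (k : ℕ) :
    ∑ ij ∈ antidiagonal k, detPowCoeff (1 : K) W ij.1 • resolventCoeff (-1 : K) W ij.2 =
      W ^ k := by
  induction k with
  | zero => simp [detPowCoeff_zero, resolventCoeff_zero]
  | succ k ih =>
    have hdet := sum_detPowCoeff_mul_detPowCoeff K W k
    rw [Finset.Nat.sum_antidiagonal_succ'] at hdet ⊢
    simp only [resolventCoeff_succ, resolventCoeff_zero, smul_add, sum_add_distrib, smul_smul,
      ← sum_smul, ← mul_smul_comm, ← mul_sum, ih, detPowCoeff_zero, mul_one] at hdet ⊢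
    rw [← add_assoc, ← add_smul, hdet, zero_smul, zero_add, pow_succ']

theorem sum_resolventCoeff_mul_resolventCoeff (k : ℕ) :
    ∑ ij ∈ antidiagonal k, resolventCoeff (1 : K) W ij.1 * resolventCoeff (-1 : K) W ij.2 =
      ((k : K) + 1) • W ^ k := by
  induction k with
  | zero => simp [resolventCoeff_zero]
  | succ k ih =>
    have hdet := sum_detPowCoeff_smul_resolventCoeff K W (k + 1)
    rw [Finset.Nat.sum_antidiagonal_succ] at hdet ⊢
    simp only [detPowCoeff_zero, one_smul] at hdet
    simp only [resolventCoeff_succ (1 : K), add_mul, smul_mul_assoc, one_mul, sum_add_distrib,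
      mul_assoc, ← mul_sum, ih, resolventCoeff_zero]
    rw [← add_assoc, hdet, mul_smul_comm, ← pow_succ']
    push_cast
    module

theorem sum_hookTrace (k : ℕ) :
    ∑ ij ∈ antidiagonal k, hookTrace K W ij.1 ij.2 = trace (W ^ (k + 1)) := by
  have hk : (k : K) + 1 ≠ 0 := Nat.cast_add_one_ne_zero k
  calc ∑ ij ∈ antidiagonal k, hookTrace K W ij.1 ij.2
      = ∑ ij ∈ antidiagonal k, ((k : K) + 1)⁻¹ •
          trace (W * (resolventCoeff (1 : K) W ij.1 * resolventCoeff (-1 : K) W ij.2)) :=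
        sum_congr rfl fun ij hij => by
          rw [hookTrace, ← mem_antidiagonal.1 hij, Nat.cast_add]
    _ = trace (W ^ (k + 1)) := by
        rw [← smul_sum, ← trace_sum, ← mul_sum, sum_resolventCoeff_mul_resolventCoeff,
          mul_smul_comm, trace_smul, smul_smul, inv_mul_cancel₀ hk, one_smul, ← pow_succ']

variable {m : Type*} [Fintype m] [DecidableEq m]

variable {K} in
/-- The divergence of `c P_k Q_l`, where `P` and `Q` are the coefficients of
`det (1 - x W)^{∓1} (1 - x W)⁻¹` for `W = b c`. -/
def hookDiv (D : m → n → Derivation K A A) (b : Matrix n m A) (c : Matrix m n A) (k l : ℕ) : A :=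
  trace (matrixDiv D
    (c * (resolventCoeff (1 : K) (b * c) k * resolventCoeff (-1 : K) (b * c) l)))

namespace IsPartialDerivs

variable {K} {D : m → n → Derivation K A A} {b : Matrix n m A} {c : Matrix m n A}
  (h : IsPartialDerivs D b c)

include h

theorem trace_matrixDiv_mul_resolventCoeff {θ : K} (hθ : θ * θ = 1) (l : ℕ) :
    trace (matrixDiv D (c * resolventCoeff θ (b * c) l)) =
      (((Fintype.card n : K) + θ * l) * ((Fintype.card m : K) + θ * l)) •
        detPowCoeff θ (b * c) l := by
  rw [h.matrixDiv_mul_resolventCoeff θ hθ, trace_smul, trace_resolventCoeff θ _ hθ, smul_smul,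
    detPowCoeff_mul_comm]

theorem hookDiv_zero_right (k : ℕ) :
    hookDiv D b c k 0 = (((Fintype.card n : K) + k) * ((Fintype.card m : K) + k)) •
      detPowCoeff (1 : K) (b * c) k := by
  rw [hookDiv, resolventCoeff_zero, mul_one,
    h.trace_matrixDiv_mul_resolventCoeff (one_mul 1), one_mul]

theorem hookDiv_zero_left (l : ℕ) :
    hookDiv D b c 0 l = (((Fintype.card n : K) - l) * ((Fintype.card m : K) - l)) •
      detPowCoeff (-1 : K) (b * c) l := by
  rw [hookDiv, resolventCoeff_zero, one_mul,
    h.trace_matrixDiv_mul_resolventCoeff (by ring), neg_one_mul, ← sub_eq_add_neg,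
    ← sub_eq_add_neg]

theorem hookDiv_succ_sub (k l : ℕ) :
    hookDiv D b c (k + 1) l - hookDiv D b c k (l + 1) =
      (((Fintype.card n : K) - l) * ((Fintype.card m : K) - l)) •
        (detPowCoeff (1 : K) (b * c) (k + 1) * detPowCoeff (-1 : K) (b * c) l)
      - (((Fintype.card n : K) + k) * ((Fintype.card m : K) + k)) •
        (detPowCoeff (1 : K) (b * c) k * detPowCoeff (-1 : K) (b * c) (l + 1))
      + (2 * ((k : K) + l + 1)) • hookTrace K (b * c) k l := by
  have hright := h.hookDiv_zero_right k
  have hleft := h.hookDiv_zero_left l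
  rw [hookDiv, resolventCoeff_zero, mul_one] at hright
  rw [hookDiv, resolventCoeff_zero, one_mul] at hleft
  have hP := commute_resolventCoeff (1 : K) (Commute.refl (b * c)) k
  have hQ := commute_resolventCoeff (-1 : K) (Commute.refl (b * c)) l
  have hPQ := commute_resolventCoeff (-1 : K) hP.symm l
  rw [hookDiv, hookDiv, ← trace_sub, ← matrixDiv_sub, ← Matrix.mul_sub, resolventCoeff_mul_sub,
    Matrix.mul_sub, Matrix.mul_smul, Matrix.mul_smul, matrixDiv_sub, matrixDiv_smul, matrixDiv_smul,
    h.matrixGrad_detPowCoeff_succ, h.matrixGrad_detPowCoeff_succ]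
  simp only [trace_sub, trace_add, trace_smul, hright, hleft, one_smul, neg_smul, trace_neg,
    Matrix.mul_neg]
  rw [trace_mul_mul_mul_of_commute (hQ.mul_right hP),
    trace_mul_mul_mul_of_commute (hP.mul_right hQ), ← hPQ.eq, ← natCast_smul_hookTrace]
  simp only [smul_eq_mul, Algebra.smul_def, map_mul, map_ofNat]
  ring

theorem hookDiv_succ_succ (k l : ℕ) :
    hookDiv D b c (k + 1) (l + 1) =
      (((Fintype.card n : K) + (k + 1)) * ((Fintype.card m : K) + (k + 1))) •
        hookTrace K (b * c) k (l + 1)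
      - (((Fintype.card n : K) - (l + 1)) * ((Fintype.card m : K) - (l + 1))) •
        hookTrace K (b * c) (k + 1) l := by
  have hsub := h.hookDiv_succ_sub (k + 1) l
  induction l generalizing k with
  | zero =>
    rw [h.hookDiv_zero_right, detPowCoeff_mul_detPowCoeff, detPowCoeff_zero, mul_one,
      ← hookTrace_zero_right] at hsub
    simp only [Algebra.smul_def, Nat.cast_succ, Nat.cast_zero, map_mul, map_ofNat, map_add, map_sub,
      map_natCast, map_one, map_zero] at hsub ⊢
    linear_combination -hsub
  | succ l ih =>
    rw [ih _ (h.hookDiv_succ_sub _ l), detPowCoeff_mul_detPowCoeff,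
      detPowCoeff_mul_detPowCoeff] at hsub
    simp only [Algebra.smul_def, Nat.cast_succ, map_mul, map_ofNat, map_add, map_sub, map_natCast,
      map_one] at hsub ⊢
    linear_combination -hsub

end IsPartialDerivs

end Hook

section Weights

variable {K : Type*} [Field K] (z w : K)

/-- The weight `∏_{0 ≤ i ≤ k} (z + i) (w + i) / k!` of a hook's arm of length `k`, including its
corner. -/
def armWeight : ℕ → K
  | 0 => z * w
  | k + 1 => (z + (k + 1)) * (w + (k + 1)) / (k + 1) * armWeight k

/-- The signed weight `∏_{1 ≤ i ≤ l} (-(z - i) (w - i) / i)` of a hook's leg of length `l`. -/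
def legWeight : ℕ → K
  | 0 => 1
  | l + 1 => -((z - (l + 1)) * (w - (l + 1)) / (l + 1)) * legWeight l

variable [CharZero K]

theorem succ_mul_armWeight_succ (k : ℕ) :
    ((k : K) + 1) * armWeight z w (k + 1) = (z + (k + 1)) * (w + (k + 1)) * armWeight z w k := by
  have hk : (k : K) + 1 ≠ 0 := Nat.cast_add_one_ne_zero k
  rw [armWeight]
  field_simp

theorem succ_mul_legWeight_succ (l : ℕ) :
    ((l : K) + 1) * legWeight z w (l + 1) = -((z - (l + 1)) * (w - (l + 1))) * legWeight z w l := by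
  have hl : (l : K) + 1 ≠ 0 := Nat.cast_add_one_ne_zero l
  rw [legWeight]
  field_simp

end Weights

section Expectation

variable {K : Type*} [Field K] {A : Type*} [CommRing A] [Algebra K A]
  {n m : Type*} [Fintype n] [Fintype m] {D : m → n → Derivation K A A} {b : Matrix n m A}
  {E : A →ₗ[K] K} {τ : K}

theorem apply_trace_mul (hE : ∀ i j f, E (b i j * f) = τ * E (D j i f)) (G : Matrix m n A) :
    E (trace (b * G)) = τ * E (trace (matrixDiv D G)) := by
  simp only [trace, diag_apply, mul_apply, map_sum, hE, matrixDiv, of_apply, mul_sum]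
  exact sum_comm

variable [DecidableEq n] [CharZero K]

theorem succ_mul_apply_hookTrace (hE : ∀ i j f, E (b i j * f) = τ * E (D j i f))
    (c : Matrix m n A) (k l : ℕ) :
    ((k : K) + l + 1) * E (hookTrace K (b * c) k l) = τ * E (hookDiv D b c k l) := by
  rw [← smul_eq_mul, ← map_smul, natCast_smul_hookTrace, Matrix.mul_assoc, apply_trace_mul hE,
    hookDiv]

variable [DecidableEq m] {c : Matrix m n A}

namespace IsPartialDerivs

variable (h : IsPartialDerivs D b c) (hE : ∀ i j f, E (b i j * f) = τ * E (D j i f))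

include h hE

theorem apply_hookTrace_zero_zero :
    E (hookTrace K (b * c) 0 0) = τ * (Fintype.card n * Fintype.card m * E 1) := by
  simpa [h.hookDiv_zero_left, detPowCoeff_zero] using succ_mul_apply_hookTrace hE c 0 0

theorem apply_hookTrace_zero_succ (l : ℕ) :
    ((l : K) + 2) * E (hookTrace K (b * c) 0 (l + 1)) =
      -τ * ((Fintype.card n - (l + 1)) * (Fintype.card m - (l + 1))) *
        E (hookTrace K (b * c) 0 l) := by
  have hrec := succ_mul_apply_hookTrace hE c 0 (l + 1)
  rw [h.hookDiv_zero_left, ← neg_neg (detPowCoeff (-1 : K) _ _), ← hookTrace_zero_left, map_smul,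
    map_neg, smul_eq_mul] at hrec
  push_cast at hrec
  linear_combination hrec

theorem apply_hookTrace_succ_zero (k : ℕ) :
    ((k : K) + 2) * E (hookTrace K (b * c) (k + 1) 0) =
      τ * ((Fintype.card n + (k + 1)) * (Fintype.card m + (k + 1))) *
        E (hookTrace K (b * c) k 0) := by
  have hrec := succ_mul_apply_hookTrace hE c (k + 1) 0
  rw [h.hookDiv_zero_right, ← hookTrace_zero_right, map_smul, smul_eq_mul] at hrec
  push_cast at hrec
  linear_combination hrec

theorem apply_hookTrace_succ_succ (k l : ℕ) :
    ((k : K) + l + 3) * E (hookTrace K (b * c) (k + 1) (l + 1)) =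
      τ * ((Fintype.card n + (k + 1)) * (Fintype.card m + (k + 1)) *
          E (hookTrace K (b * c) k (l + 1))
        - (Fintype.card n - (l + 1)) * (Fintype.card m - (l + 1)) *
          E (hookTrace K (b * c) (k + 1) l)) := by
  have hrec := succ_mul_apply_hookTrace hE c (k + 1) (l + 1)
  rw [h.hookDiv_succ_succ, map_sub, map_smul, map_smul, smul_eq_mul, smul_eq_mul] at hrec
  push_cast at hrec
  linear_combination hrec

theorem apply_hookTrace (hE1 : E 1 = 1) (k l : ℕ) :
    ((k : K) + l + 1) * E (hookTrace K (b * c) k l) =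
      τ ^ (k + l + 1) * (armWeight (Fintype.card n : K) (Fintype.card m) k *
        legWeight (Fintype.card n : K) (Fintype.card m) l) := by
  induction k generalizing l with
  | zero =>
    induction l with
    | zero => simp [h.apply_hookTrace_zero_zero hE, hE1, armWeight, legWeight]
    | succ l ih =>
      have hleg := succ_mul_legWeight_succ (Fintype.card n : K) (Fintype.card m) l
      have hrec := h.apply_hookTrace_zero_succ hE l
      refine mul_left_cancel₀ (Nat.cast_add_one_ne_zero l) ?_
      push_cast at ih ⊢
      linear_combination (l + 1 : K) * hrec - τ *
        ((Fintype.card n - (l + 1)) * (Fintype.card m - (l + 1))) * ih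
        - τ ^ (l + 2) * armWeight (Fintype.card n : K) (Fintype.card m) 0 * hleg
  | succ k ihk =>
    have harm := succ_mul_armWeight_succ (Fintype.card n : K) (Fintype.card m) k
    induction l with
    | zero =>
      have hrec := h.apply_hookTrace_succ_zero hE k
      have ih := ihk 0
      refine mul_left_cancel₀ (Nat.cast_add_one_ne_zero k) ?_
      push_cast at ih ⊢
      linear_combination (k + 1 : K) * hrec + τ *
        ((Fintype.card n + (k + 1)) * (Fintype.card m + (k + 1))) * ih
        - τ ^ (k + 2) * legWeight (Fintype.card n : K) (Fintype.card m) 0 * harm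
    | succ l ihl =>
      have hleg := succ_mul_legWeight_succ (Fintype.card n : K) (Fintype.card m) l
      have hrec := h.apply_hookTrace_succ_succ hE k l
      have ih := ihk (l + 1)
      refine mul_left_cancel₀ (Nat.cast_add_one_ne_zero (k + l + 1)) ?_
      push_cast at ih ihl ⊢
      linear_combination (k + l + 2 : K) * hrec
        + τ * ((Fintype.card n + (k + 1)) * (Fintype.card m + (k + 1))) * ih
        - τ * ((Fintype.card n - (l + 1)) * (Fintype.card m - (l + 1))) * ihl
        - τ ^ (k + l + 3) * legWeight (Fintype.card n : K) (Fintype.card m) (l + 1) * harm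
        - τ ^ (k + l + 3) * armWeight (Fintype.card n : K) (Fintype.card m) (k + 1) * hleg

theorem succ_mul_apply_trace_pow_succ (hE1 : E 1 = 1) (k : ℕ) :
    ((k : K) + 1) * E (trace ((b * c) ^ (k + 1))) =
      τ ^ (k + 1) * ∑ ij ∈ antidiagonal k, armWeight (Fintype.card n : K) (Fintype.card m) ij.1 *
        legWeight (Fintype.card n : K) (Fintype.card m) ij.2 := by
  rw [← sum_hookTrace K, map_sum, mul_sum, mul_sum]
  refine sum_congr rfl fun ij hij => ?_
  have hij : ij.1 + ij.2 = k := mem_antidiagonal.1 hij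
  rw [← hij, ← h.apply_hookTrace hE hE1, Nat.cast_add]

end IsPartialDerivs

end Expectation

section Recurrence

variable {K : Type*} [Field K] (z w : K)

/-- The moments `∑_{i+j=k} φ(i, j) u_i v_j` of the arm weights `u` and the leg weights `v`. -/
def hookSum (φ : ℕ → ℕ → K) (k : ℕ) : K :=
  ∑ ij ∈ antidiagonal k, φ ij.1 ij.2 * (armWeight z w ij.1 * legWeight z w ij.2)

theorem hookSum_congr {k : ℕ} {φ ψ : ℕ → ℕ → K} (h : ∀ i j, i + j = k → φ i j = ψ i j) :
    hookSum z w φ k = hookSum z w ψ k :=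
  sum_congr rfl fun ij hij => by rw [h _ _ (mem_antidiagonal.1 hij)]

theorem hookSum_add (φ ψ : ℕ → ℕ → K) (k : ℕ) :
    hookSum z w (fun i j => φ i j + ψ i j) k = hookSum z w φ k + hookSum z w ψ k := by
  simp only [hookSum, add_mul, sum_add_distrib]

theorem hookSum_mul_left (a : K) (φ : ℕ → ℕ → K) (k : ℕ) :
    hookSum z w (fun i j => a * φ i j) k = a * hookSum z w φ k := by
  simp only [hookSum, mul_assoc, mul_sum]

/-- The moments `E tr W^k` of a Wishart matrix `W = B B†`, for `z × w` matrices `B` of independent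
complex Gaussians of unit variance. -/
def wishartMoment : ℕ → K
  | 0 => z
  | k + 1 => hookSum z w (fun _ _ => 1) k / (k + 1)

theorem wishartMoment_one : wishartMoment z w 1 = z * w := by
  simp [wishartMoment, hookSum, armWeight, legWeight]

variable [CharZero K]

theorem succ_mul_wishartMoment_succ (k : ℕ) :
    ((k : K) + 1) * wishartMoment z w (k + 1) = hookSum z w (fun _ _ => 1) k :=
  mul_div_cancel₀ _ (Nat.cast_add_one_ne_zero k)

theorem hookSum_natCast_fst_mul_succ (φ : ℕ → ℕ → K) (k : ℕ) :
    hookSum z w (fun i j => i * φ i j) (k + 1) =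
      hookSum z w (fun i j => (z + i + 1) * (w + i + 1) * φ (i + 1) j) k := by
  rw [hookSum, Finset.Nat.sum_antidiagonal_succ, hookSum, Nat.cast_zero, zero_mul, zero_mul,
    zero_add]
  refine sum_congr rfl fun ij _ => ?_
  push_cast
  linear_combination φ (ij.1 + 1) ij.2 * legWeight z w ij.2 * succ_mul_armWeight_succ z w ij.1

theorem hookSum_natCast_snd_mul_succ (φ : ℕ → ℕ → K) (k : ℕ) :
    hookSum z w (fun i j => j * φ i j) (k + 1) =
      hookSum z w (fun i j => -((z - j - 1) * (w - j - 1)) * φ i (j + 1)) k := by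
  rw [hookSum, Finset.Nat.sum_antidiagonal_succ', hookSum, Nat.cast_zero, zero_mul, zero_mul,
    zero_add]
  refine sum_congr rfl fun ij _ => ?_
  push_cast
  linear_combination φ ij.1 (ij.2 + 1) * armWeight z w ij.1 * succ_mul_legWeight_succ z w ij.2

theorem hookSum_one_succ (k : ℕ) :
    ((k : K) + 1) * hookSum z w (fun _ _ => 1) (k + 1) = ((k : K) + 2) *
      ((z + w) * hookSum z w (fun _ _ => 1) k + hookSum z w (fun i j => (i : K) - j) k) := by
  have h := congrArg₂ (· + ·) (hookSum_natCast_fst_mul_succ z w (fun _ _ => 1) k)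
    (hookSum_natCast_snd_mul_succ z w (fun _ _ => 1) k)
  simp only [← hookSum_add] at h
  rw [← hookSum_mul_left, ← hookSum_mul_left, ← hookSum_add, ← hookSum_mul_left]
  convert h using 1
  · refine hookSum_congr z w fun i j hij => ?_
    have hij : (i : K) + j = k + 1 := by exact_mod_cast hij
    linear_combination -hij
  · refine hookSum_congr z w fun i j hij => ?_
    rw [← hij, Nat.cast_add]
    ring

theorem hookSum_sub_succ (k : ℕ) :
    ((k : K) + 4) * hookSum z w (fun i j => (i : K) - j) (k + 1) = ((k : K) + 2) *
      ((4 * z * w + (k + 2) ^ 2) * hookSum z w (fun _ _ => 1) k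
        + (z + w) * hookSum z w (fun i j => (i : K) - j) k) := by
  have h := congrArg₂ (· + ·)
    (hookSum_natCast_fst_mul_succ z w (fun i j => 2 * k + 5 - ((i : K) - j)) k)
    (hookSum_natCast_snd_mul_succ z w (fun i j => -(2 * k + 5) - ((i : K) - j)) k)
  simp only [← hookSum_add] at h
  rw [← hookSum_mul_left, ← hookSum_mul_left, ← hookSum_mul_left, ← hookSum_add,
    ← hookSum_mul_left]
  convert h using 1
  · refine hookSum_congr z w fun i j hij => ?_
    have hij : (i : K) + j = k + 1 := by exact_mod_cast hij
    linear_combination ((i : K) - j) * hij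
  · refine hookSum_congr z w fun i j hij => ?_
    rw [← hij]
    push_cast
    ring

/-- The three-term recurrence of Haagerup and Thorbjørnsen. -/
theorem wishartMoment_recurrence (k : ℕ) :
    ((k : K) + 3) * wishartMoment z w (k + 2) = (2 * k + 3) * (z + w) * wishartMoment z w (k + 1)
      + k * ((k + 1) ^ 2 - (z - w) ^ 2) * wishartMoment z w k := by
  cases k with
  | zero =>
    have hone := hookSum_one_succ z w 0
    have hsub : hookSum z w (fun i j => (i : K) - j) 0 = 0 := by simp [hookSum]
    rw [hsub, ← succ_mul_wishartMoment_succ, ← succ_mul_wishartMoment_succ] at hone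
    push_cast at hone ⊢
    linear_combination 3 / 2 * hone
  | succ k =>
    have hone := hookSum_one_succ z w k
    have hone' := hookSum_one_succ z w (k + 1)
    have hsub := hookSum_sub_succ z w k
    simp only [← succ_mul_wishartMoment_succ] at hone hone' hsub
    have hk : ((k + 2) * (k + 3) : K) ≠ 0 := by
      exact_mod_cast Nat.mul_ne_zero (Nat.succ_ne_zero (k + 1)) (Nat.succ_ne_zero (k + 2))
    refine mul_left_cancel₀ hk ?_
    push_cast at hone hone' hsub ⊢
    linear_combination (k + 4 : K) * hone' + (k + 3 : K) * (hsub - (z + w) * hone)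

end Recurrence

section GaussianMeasure

open MeasureTheory

theorem pi_tilted {ι : Type*} [Fintype ι] {α : ι → Type*} [∀ i, MeasurableSpace (α i)]
    (μ : ∀ i, Measure (α i)) [∀ i, SigmaFinite (μ i)] (f : ∀ i, α i → ℝ) :
    Measure.pi (fun i => (μ i).tilted (f i)) =
      (Measure.pi μ).tilted fun x => ∑ i, f i (x i) := by
  refine Measure.pi_eq fun s hs => ?_
  have hexp (x : ∀ i, α i) :
      Real.exp (∑ i, f i (x i)) / ∫ x, Real.exp (∑ i, f i (x i)) ∂Measure.pi μ =
        ∏ i, Real.exp (f i (x i)) / ∫ a, Real.exp (f i a) ∂μ i := by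
    simp only [Real.exp_sum, integral_fintype_prod_eq_prod fun i a => Real.exp (f i a),
      prod_div_distrib]
  rw [tilted_apply_eq_ofReal_integral' _ (MeasurableSet.univ_pi hs), Measure.restrict_pi_pi]
  simp only [hexp]
  rw [integral_fintype_prod_eq_prod fun i a => Real.exp (f i a) / ∫ a, Real.exp (f i a) ∂μ i,
    ENNReal.ofReal_prod_of_nonneg fun i _ => by positivity]
  exact prod_congr rfl fun i _ => (tilted_apply_eq_ofReal_integral' _ (hs i)).symm

/-- The centred complex Gaussian distribution with density proportional to `e^{-β |z|²}`. -/
def complexGaussian (β : ℝ) : Measure ℂ :=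
  volume.tilted fun z => -β * ‖z‖ ^ 2

instance (β : ℝ) : IsZeroOrProbabilityMeasure (complexGaussian β) := by
  unfold complexGaussian; infer_instance

theorem integral_comp_mul_complexGaussian {E : Type*} [NormedAddCommGroup E] [NormedSpace ℝ E]
    (β : ℝ) {u : ℂ} (hu : ‖u‖ = 1) (F : ℂ → E) :
    ∫ z, F (u * z) ∂complexGaussian β = ∫ z, F z ∂complexGaussian β := by
  let e := rotation (⟨u, by simpa [Submonoid.unitSphere] using hu⟩ : Circle)
  have he (z : ℂ) : e z = u * z := rfl
  have h := e.measurePreserving.integral_comp e.toHomeomorph.measurableEmbedding fun z =>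
    (Real.exp (-β * ‖z‖ ^ 2) / ∫ z : ℂ, Real.exp (-β * ‖z‖ ^ 2)) • F z
  simp only [he, norm_mul, hu, one_mul] at h
  rw [complexGaussian, integral_tilted, integral_tilted, h]

/-- The moments `E z^p (conj z)^q` of the centred complex Gaussian distribution. -/
def complexMoment (β : ℝ) (p q : ℕ) : ℂ :=
  ∫ z, z ^ p * (starRingEnd ℂ z) ^ q ∂complexGaussian β

theorem complexMoment_of_ne (β : ℝ) {p q : ℕ} (h : p ≠ q) : complexMoment β p q = 0 := by
  set θ : ℝ := Real.pi / (p - q) with hθ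
  set u : ℂ := Complex.exp (θ * Complex.I) with hu
  have hu_pow : u ^ p * (starRingEnd ℂ u) ^ q = -1 := by
    have hpq : (p : ℂ) - q ≠ 0 := sub_ne_zero.2 (by exact_mod_cast h)
    rw [hu, ← Complex.exp_conj, ← Complex.exp_nat_mul, ← Complex.exp_nat_mul, ← Complex.exp_add,
      ← Complex.exp_pi_mul_I, hθ]
    congr 1
    simp only [map_mul, Complex.conj_ofReal, Complex.conj_I]
    push_cast
    field_simp
    ring
  have hrot := integral_comp_mul_complexGaussian β (Complex.norm_exp_ofReal_mul_I θ)
    fun z => z ^ p * (starRingEnd ℂ z) ^ q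
  simp only [← hu, map_mul, mul_pow, mul_mul_mul_comm _ _ ((starRingEnd ℂ u) ^ q), hu_pow,
    integral_const_mul] at hrot
  change -1 * complexMoment β p q = complexMoment β p q at hrot
  linear_combination -hrot / 2

variable {β : ℝ}

theorem integral_norm_pow_mul_exp (hβ : 0 < β) (p : ℕ) :
    ∫ z : ℂ, ‖z‖ ^ p * Real.exp (-β * ‖z‖ ^ 2) =
      Real.pi * β ^ (-((p : ℝ) + 2) / 2) * Real.Gamma (((p : ℝ) + 2) / 2) := by
  have h := Complex.integral_rpow_mul_exp_neg_mul_rpow (p := 2) (q := p) (b := β) (by norm_num)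
    (by have := (Nat.cast_nonneg p : (0 : ℝ) ≤ p); linarith) hβ
  simpa [Real.rpow_natCast] using h

theorem integral_norm_pow_two_mul_mul_exp (hβ : 0 < β) (p : ℕ) :
    ∫ z : ℂ, ‖z‖ ^ (2 * p) * Real.exp (-β * ‖z‖ ^ 2) =
      Real.pi * β⁻¹ ^ (p + 1) * p.factorial := by
  have hp : (((2 * p : ℕ) : ℝ) + 2) / 2 = p + 1 := by push_cast; ring
  rw [integral_norm_pow_mul_exp hβ, neg_div, hp, Real.Gamma_nat_eq_factorial,
    Real.rpow_neg hβ.le, ← Nat.cast_add_one, Real.rpow_natCast, ← inv_pow]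

theorem integrable_norm_pow_mul_exp (hβ : 0 < β) (p : ℕ) :
    Integrable fun z : ℂ => ‖z‖ ^ p * Real.exp (-β * ‖z‖ ^ 2) := by
  refine Integrable.of_integral_ne_zero ?_
  rw [integral_norm_pow_mul_exp hβ]
  have : 0 < Real.Gamma (((p : ℝ) + 2) / 2) := Real.Gamma_pos_of_pos (by positivity)
  positivity

theorem integrable_exp_neg_mul_norm_sq (hβ : 0 < β) :
    Integrable fun z : ℂ => Real.exp (-β * ‖z‖ ^ 2) := by
  simpa using integrable_norm_pow_mul_exp hβ 0

theorem isProbabilityMeasure_complexGaussian (hβ : 0 < β) :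
    IsProbabilityMeasure (complexGaussian β) :=
  isProbabilityMeasure_tilted (integrable_exp_neg_mul_norm_sq hβ)

theorem integrable_pow_mul_conj_pow_complexGaussian (hβ : 0 < β) (p q : ℕ) :
    Integrable (fun z : ℂ => z ^ p * (starRingEnd ℂ z) ^ q) (complexGaussian β) := by
  rw [complexGaussian, integrable_tilted_iff (integrable_exp_neg_mul_norm_sq hβ)]
  refine (integrable_norm_pow_mul_exp hβ (p + q)).mono' ?_ (.of_forall fun z => ?_)
  · exact Continuous.aestronglyMeasurable (by fun_prop)
  · simp only [norm_smul, norm_mul, norm_pow, RCLike.norm_conj, Real.norm_eq_abs, Real.abs_exp]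
    rw [pow_add, mul_comm]

theorem integral_norm_pow_complexGaussian (hβ : 0 < β) (p : ℕ) :
    ∫ z, ‖z‖ ^ (2 * p) ∂complexGaussian β = β⁻¹ ^ p * p.factorial := by
  have hpi : Real.pi * β⁻¹ ≠ 0 := by positivity
  have hZ : ∫ z : ℂ, Real.exp (-β * ‖z‖ ^ 2) = Real.pi * β⁻¹ := by
    simpa using integral_norm_pow_two_mul_mul_exp hβ 0
  simp only [complexGaussian, integral_tilted, smul_eq_mul, div_mul_eq_mul_div, integral_div,
    mul_comm (Real.exp _), integral_norm_pow_two_mul_mul_exp hβ, hZ]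
  rw [pow_succ', div_eq_iff hpi]
  ring

theorem complexMoment_self (hβ : 0 < β) (p : ℕ) :
    complexMoment β p p = (β : ℂ)⁻¹ ^ p * p.factorial := by
  have hnorm (z : ℂ) : z ^ p * (starRingEnd ℂ z) ^ p = ((‖z‖ ^ (2 * p) : ℝ) : ℂ) := by
    rw [← mul_pow, Complex.mul_conj, Complex.normSq_eq_norm_sq, ← Complex.ofReal_pow, pow_mul]
  simp only [complexMoment, hnorm]
  rw [integral_complex_ofReal, integral_norm_pow_complexGaussian hβ]
  push_cast
  rfl

theorem complexMoment_succ (hβ : 0 < β) (p q : ℕ) :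
    complexMoment β (p + 1) q = (β : ℂ)⁻¹ * (q * complexMoment β p (q - 1)) := by
  cases q with
  | zero => simp [complexMoment_of_ne β (Nat.succ_ne_zero p)]
  | succ q =>
    obtain rfl | h := eq_or_ne p q
    · rw [Nat.add_sub_cancel, complexMoment_self hβ, complexMoment_self hβ, Nat.factorial_succ]
      push_cast
      ring
    · rw [Nat.add_sub_cancel, complexMoment_of_ne β h,
        complexMoment_of_ne β (Nat.succ_injective.ne h), mul_zero, mul_zero]

end GaussianMeasure

section GaussianEnsemble

open MeasureTheory

/-- The law of an `N × M` matrix with independent centred complex Gaussian entries of density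
proportional to `e^{-β |z|²}`. -/
def gaussianEnsemble (N M : ℕ) (β : ℝ) : Measure (Fin N → Fin M → ℂ) :=
  Measure.pi fun _ => Measure.pi fun _ => complexGaussian β

theorem isProbabilityMeasure_gaussianEnsemble (N M : ℕ) {β : ℝ} (hβ : 0 < β) :
    IsProbabilityMeasure (gaussianEnsemble N M β) := by
  have := isProbabilityMeasure_complexGaussian hβ
  unfold gaussianEnsemble
  infer_instance

variable {N M : ℕ}

theorem tilted_trace_mul_conjTranspose_eq_gaussianEnsemble (N M : ℕ) (β : ℝ) :
    (volume.tilted fun b : Fin N → Fin M → ℂ => -β * (trace (of b * (of b)ᴴ)).re) =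
      gaussianEnsemble N M β := by
  have htrace (b : Fin N → Fin M → ℂ) :
      -β * (trace (of b * (of b)ᴴ)).re = ∑ i, ∑ j, -β * ‖b i j‖ ^ 2 := by
    simp only [trace, diag_apply, mul_apply, conjTranspose_apply, of_apply, Complex.re_sum,
      RCLike.star_def, Complex.mul_conj, Complex.ofReal_re, Complex.normSq_eq_norm_sq, mul_sum]
  simp only [htrace, gaussianEnsemble, complexGaussian, pi_tilted]
  rfl

theorem average_eq_integral (N M : ℕ) (F : Matrix (Fin N) (Fin M) ℂ → ℂ) :
    average N M F = ∫ b, F (of b) ∂gaussianEnsemble N M N := by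
  rw [← tilted_trace_mul_conjTranspose_eq_gaussianEnsemble, integral_tilted, average,
    integral_complex_ofReal, ← integral_div]
  refine integral_congr_ae (.of_forall fun b => ?_)
  simp only [Complex.real_smul, Complex.ofReal_div]
  ring

/-- The entries of an `N × M` matrix and their conjugates, as independent variables. -/
abbrev EntryVar (N M : ℕ) : Type :=
  (Fin N × Fin M) ⊕ (Fin N × Fin M)

/-- The values of the variables `EntryVar N M` at a matrix. -/
def entryVal (b : Fin N → Fin M → ℂ) : EntryVar N M → ℂ :=
  Sum.elim (fun k => b k.1 k.2) fun k => starRingEnd ℂ (b k.1 k.2)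

theorem eval_entryVal_monomial (s : EntryVar N M →₀ ℕ) (a : ℂ) (b : Fin N → Fin M → ℂ) :
    MvPolynomial.eval (entryVal b) (MvPolynomial.monomial s a) =
      a * ∏ i, ∏ j, b i j ^ s (.inl (i, j)) * (starRingEnd ℂ (b i j)) ^ s (.inr (i, j)) := by
  rw [MvPolynomial.eval_monomial, Finsupp.prod_fintype _ _ fun _ => pow_zero _,
    Fintype.prod_sum_type, Fintype.prod_prod_type, Fintype.prod_prod_type]
  simp only [prod_mul_distrib, entryVal, Sum.elim_inl, Sum.elim_inr]

variable {β : ℝ} (hβ : 0 < β)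

include hβ in
theorem integrable_eval_entryVal (f : MvPolynomial (EntryVar N M) ℂ) :
    Integrable (fun b => MvPolynomial.eval (entryVal b) f) (gaussianEnsemble N M β) := by
  have := isProbabilityMeasure_complexGaussian hβ
  induction f using MvPolynomial.induction_on' with
  | monomial s a =>
    simp only [eval_entryVal_monomial]
    refine Integrable.const_mul (Integrable.fintype_prod_dep (f := fun i (y : Fin M → ℂ) => ∏ j,
      y j ^ s (.inl (i, j)) * (starRingEnd ℂ (y j)) ^ s (.inr (i, j))) fun i => ?_) a
    exact Integrable.fintype_prod_dep
      (f := fun j (z : ℂ) => z ^ s (.inl (i, j)) * (starRingEnd ℂ z) ^ s (.inr (i, j)))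
      fun j => integrable_pow_mul_conj_pow_complexGaussian hβ _ _
  | add p q hp hq =>
    simp only [map_add]
    exact hp.add hq

/-- The expectation of polynomials in the entries of a Gaussian matrix and their conjugates. -/
def gaussExpect (N M : ℕ) {β : ℝ} (hβ : 0 < β) : MvPolynomial (EntryVar N M) ℂ →ₗ[ℂ] ℂ where
  toFun f := ∫ b, MvPolynomial.eval (entryVal b) f ∂gaussianEnsemble N M β
  map_add' f g := by
    simp only [map_add]
    exact integral_add (integrable_eval_entryVal hβ f) (integrable_eval_entryVal hβ g)
  map_smul' a f := by
    simp only [MvPolynomial.smul_eval, integral_const_mul, RingHom.id_apply, smul_eq_mul]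

theorem gaussExpect_apply (f : MvPolynomial (EntryVar N M) ℂ) :
    gaussExpect N M hβ f = ∫ b, MvPolynomial.eval (entryVal b) f ∂gaussianEnsemble N M β :=
  rfl

theorem gaussExpect_one : gaussExpect N M hβ 1 = 1 := by
  have := isProbabilityMeasure_gaussianEnsemble N M hβ
  simp [gaussExpect_apply]

theorem gaussExpect_monomial (s : EntryVar N M →₀ ℕ) (a : ℂ) :
    gaussExpect N M hβ (MvPolynomial.monomial s a) =
      a * ∏ k : Fin N × Fin M, complexMoment β (s (.inl k)) (s (.inr k)) := by
  have := isProbabilityMeasure_complexGaussian hβ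
  simp only [gaussExpect_apply, eval_entryVal_monomial, integral_const_mul, gaussianEnsemble]
  rw [Fintype.prod_prod_type, integral_fintype_prod_eq_prod fun i (y : Fin M → ℂ) => ∏ j,
    y j ^ s (.inl (i, j)) * (starRingEnd ℂ (y j)) ^ s (.inr (i, j))]
  congr 1
  refine prod_congr rfl fun i _ => ?_
  exact integral_fintype_prod_eq_prod fun j (z : ℂ) =>
    z ^ s (.inl (i, j)) * (starRingEnd ℂ z) ^ s (.inr (i, j))

/-- Gaussian integration by parts. -/
theorem gaussExpect_X_mul (k : Fin N × Fin M) (f : MvPolynomial (EntryVar N M) ℂ) :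
    gaussExpect N M hβ (MvPolynomial.X (.inl k) * f) =
      (β : ℂ)⁻¹ * gaussExpect N M hβ (MvPolynomial.pderiv (.inr k) f) := by
  induction f using MvPolynomial.induction_on' with
  | monomial s a =>
    have hoff : ∀ l ∈ univ.erase k,
        complexMoment β ((Finsupp.single (.inl k) 1 + s : EntryVar N M →₀ ℕ) (.inl l))
          ((Finsupp.single (.inl k) 1 + s : EntryVar N M →₀ ℕ) (.inr l)) =
        complexMoment β ((s - Finsupp.single (.inr k) 1 : EntryVar N M →₀ ℕ) (.inl l))
          ((s - Finsupp.single (.inr k) 1 : EntryVar N M →₀ ℕ) (.inr l)) := by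
      intro l hl
      simp [(ne_of_mem_erase hl).symm]
    rw [MvPolynomial.pderiv_monomial, MvPolynomial.X, MvPolynomial.monomial_mul, one_mul,
      gaussExpect_monomial, gaussExpect_monomial, ← mul_prod_erase _ _ (mem_univ k),
      ← mul_prod_erase (a := k) univ (fun l => complexMoment β ((s - _) (.inl l)) _) (mem_univ k),
      prod_congr rfl hoff]
    simp only [Finsupp.add_apply, Finsupp.tsub_apply, Finsupp.single_eq_same, Finsupp.single_apply,
      reduceCtorEq, if_false, zero_add, Nat.sub_zero]
    rw [add_comm 1, complexMoment_succ hβ]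
    ring
  | add p q hp hq => simp only [map_add, mul_add, hp, hq]

/-- The `N × M` matrix of the variables standing for the entries. -/
def genericMatrix (N M : ℕ) : Matrix (Fin N) (Fin M) (MvPolynomial (EntryVar N M) ℂ) :=
  of fun i j => MvPolynomial.X (.inl (i, j))

/-- The `M × N` matrix of the variables standing for the entries of the adjoint matrix. -/
def genericAdjoint (N M : ℕ) : Matrix (Fin M) (Fin N) (MvPolynomial (EntryVar N M) ℂ) :=
  of fun j i => MvPolynomial.X (.inr (i, j))

theorem isPartialDerivs_pderiv (N M : ℕ) :
    IsPartialDerivs (fun j i => MvPolynomial.pderiv (R := ℂ) (.inr (i, j) : EntryVar N M))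
      (genericMatrix N M) (genericAdjoint N M) where
  apply_left j i i' j' := by simp [genericMatrix, MvPolynomial.pderiv_X]
  apply_right j i j' i' := by
    simp [genericAdjoint, MvPolynomial.pderiv_X, Pi.single_apply, and_comm]

theorem eval_entryVal_trace_pow (b : Fin N → Fin M → ℂ) (p : ℕ) :
    MvPolynomial.eval (entryVal b) (trace ((genericMatrix N M * genericAdjoint N M) ^ p)) =
      trace ((of b * (of b)ᴴ) ^ p) := by
  rw [AddMonoidHom.map_trace, ← RingHom.mapMatrix_apply, map_pow, RingHom.mapMatrix_apply,
    Matrix.map_mul]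
  congr 3 <;> ext i j <;> simp [genericMatrix, genericAdjoint, entryVal]

include hβ in
theorem integrable_trace_pow (p : ℕ) :
    Integrable (fun b => trace ((of b * (of b)ᴴ) ^ p)) (gaussianEnsemble N M β) := by
  simpa only [eval_entryVal_trace_pow] using
    integrable_eval_entryVal hβ (trace ((genericMatrix N M * genericAdjoint N M) ^ p))

include hβ in
theorem integral_trace_pow (p : ℕ) :
    ∫ b, trace ((of b * (of b)ᴴ) ^ p) ∂gaussianEnsemble N M β =
      (β : ℂ)⁻¹ ^ p * wishartMoment (N : ℂ) M p := by
  simp only [← eval_entryVal_trace_pow, ← gaussExpect_apply hβ]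
  cases p with
  | zero =>
    rw [pow_zero, trace_one, Fintype.card_fin, ← nsmul_one, map_nsmul, gaussExpect_one]
    simp [wishartMoment]
  | succ p =>
    have hk : (p : ℂ) + 1 ≠ 0 := Nat.cast_add_one_ne_zero p
    refine mul_left_cancel₀ hk ?_
    rw [(isPartialDerivs_pderiv N M).succ_mul_apply_trace_pow_succ (E := gaussExpect N M hβ)
      (τ := (β : ℂ)⁻¹) (fun i j f => gaussExpect_X_mul hβ (i, j) f) (gaussExpect_one hβ),
      mul_left_comm, succ_mul_wishartMoment_succ]
    simp [hookSum]

theorem average_trace_pow (hN : 0 < N) (p : ℕ) :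
    average N M (fun B => trace ((B * Bᴴ) ^ p)) = (N : ℂ)⁻¹ ^ p * wishartMoment (N : ℂ) M p := by
  rw [average_eq_integral, integral_trace_pow (Nat.cast_pos.2 hN), Complex.ofReal_natCast]

end GaussianEnsemble

section Resolvent

open MeasureTheory Bornology

variable {n : Type*} [Fintype n] [DecidableEq n] {A : Matrix n n ℂ}

theorem trace_conjStarAlgAut (U : unitary (Matrix n n ℂ)) (A : Matrix n n ℂ) :
    trace (Unitary.conjStarAlgAut ℂ _ U A) = trace A := by
  rw [Unitary.conjStarAlgAut_apply, trace_mul_comm, ← Matrix.mul_assoc,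
    Unitary.coe_star_mul_self, Matrix.one_mul]

theorem trace_pow_eq_sum_eigenvalues (hA : A.IsHermitian) (p : ℕ) :
    trace (A ^ p) = ∑ i, (hA.eigenvalues i : ℂ) ^ p := by
  conv_lhs => rw [hA.spectral_theorem, ← map_pow, trace_conjStarAlgAut, diagonal_pow]
  simp [trace_diagonal]

theorem trace_inv_scalar_sub_eq_sum (hA : A.IsHermitian) {x : ℂ}
    (hx : ∀ i, x ≠ hA.eigenvalues i) :
    trace ((scalar n x - A)⁻¹) = ∑ i, (x - hA.eigenvalues i)⁻¹ := by
  set φ := Unitary.conjStarAlgAut ℂ (Matrix n n ℂ) hA.eigenvectorUnitary with hφ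
  have hscalar : scalar n x - A = φ (diagonal fun i => x - hA.eigenvalues i) := by
    have hsmul : φ (scalar n x) = scalar n x := by
      rw [scalar_apply, ← smul_one_eq_diagonal, map_smul, map_one]
    conv_lhs => rw [hA.spectral_theorem, ← hφ, ← hsmul, ← map_sub, scalar_apply, diagonal_sub]
    rfl
  have hinv : (scalar n x - A)⁻¹ = φ (diagonal fun i => (x - hA.eigenvalues i)⁻¹) := by
    refine inv_eq_right_inv ?_
    rw [hscalar, ← map_mul, diagonal_mul_diagonal]
    simp only [mul_inv_cancel₀ (sub_ne_zero.2 (hx _)), diagonal_one, map_one]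
  rw [hinv, trace_conjStarAlgAut, trace_diagonal]

theorem inv_sub_sub_sum {K : Type*} [Field K] {x t : K} (hx : x ≠ 0) (hxt : x ≠ t) (P : ℕ) :
    (x - t)⁻¹ - ∑ p ∈ range P, t ^ p / x ^ (p + 1) = t ^ P / (x ^ P * (x - t)) := by
  have h : x - t ≠ 0 := sub_ne_zero.2 hxt
  induction P with
  | zero => simp
  | succ P ih =>
    rw [sum_range_succ, ← sub_sub, ih]
    field_simp
    ring

variable {δ : ℝ} {x : ℂ}

theorem ne_ofReal_of_mem_sector (hδ : 0 < δ) (hx : x ≠ 0) (hxs : x ∈ sector δ) {t : ℝ}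
    (ht : 0 ≤ t) : x ≠ t := by
  have hpos : 0 < δ * ‖x‖ := mul_pos hδ (norm_pos_iff.2 hx)
  exact sub_ne_zero.1 (norm_pos_iff.1 (hpos.trans_le (hxs t ht)))

theorem norm_inv_sub_sub_sum_le (hδ : 0 < δ) (hx : x ≠ 0) (hxs : x ∈ sector δ) {t : ℝ}
    (ht : 0 ≤ t) (P : ℕ) :
    ‖(x - t)⁻¹ - ∑ p ∈ range P, (t : ℂ) ^ p / x ^ (p + 1)‖ ≤
      t ^ P * (δ⁻¹ * ‖1 / x ^ (P + 1)‖) := by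
  have : 0 < ‖x‖ := norm_pos_iff.2 hx
  rw [inv_sub_sub_sum hx (ne_ofReal_of_mem_sector hδ hx hxs ht)]
  simp only [norm_div, norm_mul, norm_pow, norm_one, Complex.norm_of_nonneg ht]
  calc t ^ P / (‖x‖ ^ P * ‖x - t‖) ≤ t ^ P / (‖x‖ ^ P * (δ * ‖x‖)) := by
        gcongr
        exact hxs t ht
    _ = t ^ P * (δ⁻¹ * (1 / ‖x‖ ^ (P + 1))) := by
        field_simp
        ring

open scoped ComplexOrder in
theorem norm_trace_resolvent_sub_sum_le (hA : A.PosSemidef) (hδ : 0 < δ) (hx : x ≠ 0)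
    (hxs : x ∈ sector δ) (P : ℕ) :
    ‖trace ((scalar n x - A)⁻¹) - ∑ p ∈ range P, trace (A ^ p) / x ^ (p + 1)‖ ≤
      ‖trace (A ^ P)‖ * (δ⁻¹ * ‖1 / x ^ (P + 1)‖) := by
  set ev := hA.1.eigenvalues
  have hev (i : n) : 0 ≤ ev i := hA.eigenvalues_nonneg i
  have htrace : ‖trace (A ^ P)‖ = ∑ i, ev i ^ P := by
    rw [trace_pow_eq_sum_eigenvalues hA.1]
    norm_cast
    exact Real.norm_of_nonneg (sum_nonneg fun i _ => pow_nonneg (hev i) P)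
  rw [trace_inv_scalar_sub_eq_sum hA.1 fun i => ne_ofReal_of_mem_sector hδ hx hxs (hev i), htrace]
  simp only [trace_pow_eq_sum_eigenvalues hA.1, sum_div]
  rw [sum_comm, ← sum_sub_distrib, sum_mul]
  exact norm_sum_le_of_le _ fun i _ => norm_inv_sub_sub_sum_le hδ hx hxs (hev i) P

variable {Ω : Type*} [TopologicalSpace Ω] [MeasurableSpace Ω] [OpensMeasurableSpace Ω]
  {μ : Measure Ω} {A : Ω → Matrix n n ℂ}

theorem measurable_trace_resolvent (hA : Continuous A) (x : ℂ) :
    Measurable fun ω => trace ((scalar n x - A ω)⁻¹) := by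
  have hc : Continuous fun ω => scalar n x - A ω := continuous_const.sub hA
  simp only [Matrix.inv_def, Ring.inverse_eq_inv', trace_smul, smul_eq_mul]
  exact hc.matrix_det.measurable.inv.mul hc.matrix_adjugate.matrix_trace.measurable

open scoped ComplexOrder

variable (hA : Continuous A) (hpos : ∀ ω, (A ω).PosSemidef)
  (hint : ∀ p, Integrable (fun ω => trace (A ω ^ p)) μ)
include hA hpos hint

theorem integrable_trace_resolvent (hδ : 0 < δ) (hx : x ≠ 0) (hxs : x ∈ sector δ) :
    Integrable (fun ω => trace ((scalar n x - A ω)⁻¹)) μ := by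
  refine ((hint 0).norm.mul_const (δ⁻¹ * ‖1 / x ^ (0 + 1)‖)).mono'
    (measurable_trace_resolvent hA x).aestronglyMeasurable (.of_forall fun ω => ?_)
  simpa only [range_zero, sum_empty, sub_zero] using
    norm_trace_resolvent_sub_sum_le (hpos ω) hδ hx hxs 0

theorem integral_trace_resolvent_sub_sum (hδ : 0 < δ) (hx : x ≠ 0) (hxs : x ∈ sector δ) (P : ℕ) :
    ∫ ω, trace ((scalar n x - A ω)⁻¹) ∂μ - ∑ p ∈ range P, (∫ ω, trace (A ω ^ p) ∂μ) / x ^ (p + 1) =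
      ∫ ω, trace ((scalar n x - A ω)⁻¹) - ∑ p ∈ range P, trace (A ω ^ p) / x ^ (p + 1) ∂μ := by
  rw [integral_sub (integrable_trace_resolvent hA hpos hint hδ hx hxs)
    (integrable_finsetSum _ fun p _ => (hint p).div_const _),
    integral_finsetSum _ fun p _ => (hint p).div_const _]
  simp only [integral_div]

theorem isBigO_integral_trace_resolvent (hδ : 0 < δ) (P : ℕ) :
    (fun x => ∫ ω, trace ((scalar n x - A ω)⁻¹) ∂μ -
        ∑ p ∈ range P, (∫ ω, trace (A ω ^ p) ∂μ) / x ^ (p + 1))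
      =O[cobounded ℂ ⊓ 𝓟 (sector δ)] fun x : ℂ => 1 / x ^ (P + 1) := by
  refine IsBigO.of_bound ((∫ ω, ‖trace (A ω ^ P)‖ ∂μ) * δ⁻¹) ?_
  filter_upwards [Filter.mem_inf_of_left (eventually_ne_cobounded 0),
    Filter.mem_inf_of_right (Filter.mem_principal_self _)] with x hx hxs
  rw [integral_trace_resolvent_sub_sum hA hpos hint hδ hx hxs, mul_assoc, ← integral_mul_const]
  exact norm_integral_le_of_norm_le ((hint P).norm.mul_const _)
    (.of_forall fun ω => norm_trace_resolvent_sub_sum_le (hpos ω) hδ hx hxs P)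

end Resolvent

section OneLoopMean

open Bornology

open scoped ComplexOrder in
theorem isBigO_average_resolvent {N : ℕ} (hN : 0 < N) (M : ℕ) {δ : ℝ} (hδ : 0 < δ) (P : ℕ) :
    (fun x : ℂ => average N M (fun B => trace ((scalar (Fin N) x - B * Bᴴ)⁻¹)) -
        ∑ p ∈ range P, (N : ℂ)⁻¹ ^ p * wishartMoment (N : ℂ) M p / x ^ (p + 1))
      =O[cobounded ℂ ⊓ 𝓟 (sector δ)] fun x : ℂ => 1 / x ^ (P + 1) := by
  have hcont : Continuous fun b : Fin N → Fin M → ℂ => of b * (of b)ᴴ :=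
    have hof : Continuous fun b : Fin N → Fin M → ℂ => of b := continuous_id
    hof.matrix_mul hof.matrix_conjTranspose
  simp only [← average_trace_pow hN, average_eq_integral]
  exact isBigO_integral_trace_resolvent hcont (fun b => posSemidef_self_mul_conjTranspose _)
    (fun p => integrable_trace_pow (Nat.cast_pos.2 hN) p) hδ P

theorem isBigO_W₁_sub_sum {N : ℕ} (hN : 0 < N) {δ : ℝ} (hδ : 0 < δ) (P : ℕ) :
    (fun x : ℂ => W₁ N x - ∑ p ∈ range P,
        (N : ℂ)⁻¹ ^ (p + 1) * wishartMoment (N : ℂ) (N + 1) p / x ^ (p + 1))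
      =O[cobounded ℂ ⊓ 𝓟 (sector δ)] fun x : ℂ => 1 / x ^ (P + 1) := by
  refine ((isBigO_average_resolvent hN (N + 1) hδ P).const_mul_left (N : ℂ)⁻¹).congr_left
    fun x => ?_
  rw [W₁, mul_sub, mul_sum]
  push_cast
  congr 1
  exact sum_congr rfl fun p _ => by ring

end OneLoopMean

section MomentPolynomials

open Polynomial

/-- The polynomials `q_p` with `N⁻¹ E tr (B B†)^p = q_p(1/N)` in the `N × (N+1)` ensemble. -/
def momentPoly : ℕ → ℝ[X]
  | 0 => 1
  | 1 => 1 + X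
  | k + 2 => ((k : ℝ) + 3)⁻¹ • ((2 * (k : ℝ[X]) + 3) * (2 + X) * momentPoly (k + 1)
      + (k : ℝ[X]) * (((k : ℝ[X]) + 1) ^ 2 - 1) * X ^ 2 * momentPoly k)

theorem momentPoly_recurrence (k : ℕ) : ((k : ℝ[X]) + 3) * momentPoly (k + 2) =
    (2 * (k : ℝ[X]) + 3) * (2 + X) * momentPoly (k + 1)
      + (k : ℝ[X]) * (((k : ℝ[X]) + 1) ^ 2 - 1) * X ^ 2 * momentPoly k := by
  have hk : (k : ℝ) + 3 ≠ 0 := by positivity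
  have hC : (k : ℝ[X]) + 3 = C ((k : ℝ) + 3) := by rw [map_add, map_natCast, map_ofNat]
  rw [hC, ← smul_eq_C_mul, momentPoly, smul_inv_smul₀ hk]

theorem natDegree_momentPoly_le (p : ℕ) : (momentPoly p).natDegree ≤ p := by
  induction p using Nat.twoStepInduction with
  | zero => simp [momentPoly]
  | one => simp only [momentPoly]; compute_degree
  | more k ih ih' =>
    have h₁ : ((2 * (k : ℝ[X]) + 3) * (2 + X)).natDegree ≤ 1 := by compute_degree
    have h₂ : ((k : ℝ[X]) * (((k : ℝ[X]) + 1) ^ 2 - 1) * X ^ 2).natDegree ≤ 2 := by compute_degree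
    rw [momentPoly]
    refine (natDegree_smul_le _ _).trans (natDegree_add_le_of_degree_le ?_ ?_)
    · exact (natDegree_mul_le_of_le h₁ ih').trans (by omega)
    · exact (natDegree_mul_le_of_le h₂ ih).trans (by omega)

theorem aeval_inv_momentPoly {z : ℂ} (hz : z ≠ 0) (p : ℕ) :
    aeval z⁻¹ (momentPoly p) = z⁻¹ ^ (p + 1) * wishartMoment z (z + 1) p := by
  induction p using Nat.twoStepInduction with
  | zero => simp [momentPoly, wishartMoment, hz]
  | one =>
    rw [wishartMoment_one]
    simp only [momentPoly, map_add, map_one, aeval_X, one_add_one_eq_two]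
    field_simp
  | more k ih ih' =>
    have hk : (k : ℂ) + 3 ≠ 0 := by exact_mod_cast Nat.succ_ne_zero (k + 2)
    have h := congrArg (aeval z⁻¹) (momentPoly_recurrence k)
    simp only [map_add, map_sub, map_mul, map_pow, aeval_X, map_ofNat, map_natCast, map_one,
      ih, ih'] at h
    refine mul_left_cancel₀ hk (h.trans ?_)
    rw [mul_left_comm ((k : ℂ) + 3), wishartMoment_recurrence]
    linear_combination (-2 * (2 * (k : ℂ) + 3) * wishartMoment z (z + 1) (k + 1) *
      z⁻¹ ^ (k + 2)) * mul_inv_cancel₀ hz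

/-- The polynomials `momentPoly n`, extended by zero to negative `n`. -/
def intMomentPoly (n : ℤ) : ℝ[X] :=
  if 0 ≤ n then momentPoly n.toNat else 0

theorem intMomentPoly_natCast (n : ℕ) : intMomentPoly n = momentPoly n := by
  simp [intMomentPoly]

theorem intMomentPoly_of_neg {n : ℤ} (h : n < 0) : intMomentPoly n = 0 :=
  if_neg h.not_ge

theorem intMomentPoly_three_term (n : ℤ) :
    ((n : ℝ[X]) + 1) * intMomentPoly n =
    (2 * (n : ℝ[X]) - 1) * (2 + X) * intMomentPoly (n - 1)
      + (n : ℝ[X]) * ((n : ℝ[X]) - 2) ^ 2 * X ^ 2 * intMomentPoly (n - 2)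
      + (if n = 0 then 1 else 0) + if n = 1 then X else 0 := by
  obtain hn | hn := lt_or_ge n 0
  · rw [intMomentPoly_of_neg hn, intMomentPoly_of_neg (by omega), intMomentPoly_of_neg (by omega),
      if_neg (by omega), if_neg (by omega)]
    ring
  lift n to ℕ using hn
  match n with
  | 0 =>
    simp [intMomentPoly, momentPoly]
  | 1 =>
    simp [intMomentPoly, momentPoly]
    ring
  | k + 2 =>
    have h := momentPoly_recurrence k
    rw [show ((k + 2 : ℕ) : ℤ) - 1 = (k + 1 : ℕ) by omega,
      show ((k + 2 : ℕ) : ℤ) - 2 = k by omega, intMomentPoly_natCast, intMomentPoly_natCast,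
      intMomentPoly_natCast, if_neg (by omega), if_neg (by omega)]
    push_cast
    linear_combination h

theorem intMomentPoly_four_term (n : ℤ) :
    ((n : ℝ) + 1) • ((2 : ℝ) • intMomentPoly n + X ^ 1 * intMomentPoly n)
      - (4 * (2 * (n : ℝ) - 1)) • (intMomentPoly (n - 1) + X ^ 1 * intMomentPoly (n - 1))
      - (((n : ℝ) - 1) * (n - 2) * (n - 3)) •
        ((2 : ℝ) • (X ^ 2 * intMomentPoly (n - 2)) + X ^ 3 * intMomentPoly (n - 2))
      - (((n : ℝ) + 1) * (n - 1)) • (X ^ 2 * intMomentPoly (n - 1))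
      + (((n : ℝ) - 1) * (n - 2) * (n - 3) ^ 2) • (X ^ 4 * intMomentPoly (n - 3)) =
    (if n = 0 then (2 : ℝ) • X ^ 0 + X ^ 1 else 0)
      + if n = 1 then (2 : ℝ) • X ^ 1 + (2 : ℝ) • X ^ 2 else 0 := by
  have h := intMomentPoly_three_term n
  have h' := intMomentPoly_three_term (n - 1)
  have hdelta : ((n : ℝ[X]) - 2) * (if n - 1 = 1 then X else 0) = 0 := by
    split_ifs with hn
    · rw [show n = 2 by omega]; simp
    · exact mul_zero _
  have hdelta' : ((n : ℝ[X]) - 1) * (if n = 1 then 1 else 0) = 0 := by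
    split_ifs with hn <;> simp [hn]
  simp only [sub_sub, one_add_one_eq_two, show (1 + 2 : ℤ) = 3 from rfl, sub_eq_zero] at h' hdelta
  simp only [smul_eq_C_mul, map_add, map_mul, map_sub, map_pow, map_intCast, map_one, map_ofNat]
  push_cast at h'
  have hite₀ : (if n = 0 then 2 * X ^ 0 + X ^ 1 else 0 : ℝ[X]) =
    (2 + X) * if n = 0 then 1 else 0 := by split_ifs <;> ring
  have hite₁ : (if n = 1 then 2 * X ^ 1 + 2 * X ^ 2 else 0 : ℝ[X]) =
    (2 * X + 2 * X ^ 2) * if n = 1 then 1 else 0 := by split_ifs <;> ring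
  have hite₂ : (if n = 1 then X else 0 : ℝ[X]) = X * if n = 1 then 1 else 0 := by
    split_ifs <;> ring
  rw [hite₀, hite₁]
  rw [hite₂] at h
  linear_combination (2 + X) * h - ((n : ℝ[X]) - 2) * X ^ 2 * h' - X ^ 2 * hdelta'
    - X ^ 2 * hdelta

end MomentPolynomials

section GenusCoefficients

open Polynomial

/-- The coefficient of `X^j`, `j ∈ ℤ`, of a polynomial, which is zero for negative `j`. It lets the
recurrence of the coefficients be read off at every index without case distinction. -/
def intCoeff (j : ℤ) : ℝ[X] →ₗ[ℝ] ℝ :=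
  if 0 ≤ j then lcoeff ℝ j.toNat else 0

theorem intCoeff_natCast (j : ℕ) (q : ℝ[X]) : intCoeff j q = q.coeff j := by
  simp [intCoeff]

theorem intCoeff_of_neg {j : ℤ} (h : j < 0) (q : ℝ[X]) : intCoeff j q = 0 := by
  simp [intCoeff, h.not_ge]

theorem intCoeff_X_pow_mul (j : ℤ) (k : ℕ) (q : ℝ[X]) :
    intCoeff j (X ^ k * q) = intCoeff (j - k) q := by
  obtain hj | hj := lt_or_ge j 0
  · rw [intCoeff_of_neg hj, intCoeff_of_neg (by omega)]
  lift j to ℕ using hj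
  rw [intCoeff_natCast, coeff_X_pow_mul']
  split_ifs with hk
  · rw [← Nat.cast_sub hk, intCoeff_natCast]
  · rw [intCoeff_of_neg (by omega)]

theorem intCoeff_X_pow (j : ℤ) (k : ℕ) : intCoeff j (X ^ k) = if j = k then 1 else 0 := by
  obtain hj | hj := lt_or_ge j 0
  · rw [intCoeff_of_neg hj, if_neg (by omega)]
  lift j to ℕ using hj
  rw [intCoeff_natCast, coeff_X_pow]
  simp

/-- The coefficients `C_n^{(j/2)}` of the expansion in fractional genus: as `N^{-j} x^{-1-n-j}` is
the term of order `x^{-1-p}` with `p = n + j`, they are the coefficients of the moment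
polynomials. -/
def genusCoeff (j n : ℤ) : ℝ :=
  intCoeff j (intMomentPoly (n + j))

theorem genusCoeff_sub (j n : ℤ) : genusCoeff j (n - j) = intCoeff j (intMomentPoly n) := by
  rw [genusCoeff, sub_add_cancel]

theorem genusCoeff_of_neg {j n : ℤ} (h : j < 0 ∨ n < 0) : genusCoeff j n = 0 := by
  rw [genusCoeff]
  obtain hj | hj := lt_or_ge j 0
  · exact intCoeff_of_neg hj _
  obtain hp | hp := lt_or_ge (n + j) 0
  · rw [intMomentPoly_of_neg hp, map_zero]
  lift j to ℕ using hj
  lift n + j to ℕ using hp with p hpn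
  rw [intMomentPoly_natCast, intCoeff_natCast]
  exact coeff_eq_zero_of_natDegree_lt ((natDegree_momentPoly_le p).trans_lt (by omega))

theorem genusCoeff_recurrence (j n : ℤ) :
    ((n : ℝ) + 1) * (2 * genusCoeff j (n - j) + genusCoeff (j - 1) (n - j + 1))
      - 4 * (2 * (n : ℝ) - 1) * (genusCoeff j (n - j - 1) + genusCoeff (j - 1) (n - j))
      - ((n : ℝ) - 1) * ((n : ℝ) - 2) * ((n : ℝ) - 3) *
          (2 * genusCoeff (j - 2) (n - j) + genusCoeff (j - 3) (n - j + 1))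
      - ((n : ℝ) + 1) * ((n : ℝ) - 1) * genusCoeff (j - 2) (n - j + 1)
      + ((n : ℝ) - 1) * ((n : ℝ) - 2) * ((n : ℝ) - 3) ^ 2 * genusCoeff (j - 4) (n - j + 1)
    = 2 * (if j = 0 ∧ n = 0 then 1 else 0) + (if j = 1 ∧ n = 0 then 1 else 0)
      + 2 * (if j = 1 ∧ n = 1 then 1 else 0) + 2 * (if j = 2 ∧ n = 1 then 1 else 0) := by
  have h := congrArg (intCoeff j) (intMomentPoly_four_term n)
  simp only [map_add, map_sub, map_smul, intCoeff_X_pow_mul, smul_eq_mul, apply_ite (intCoeff j),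
    intCoeff_X_pow, map_zero, Nat.cast_zero, Nat.cast_one, Nat.cast_ofNat] at h
  simp only [genusCoeff]
  ring_nf at h ⊢
  rw [h]
  obtain rfl | hn₀ := eq_or_ne n 0
  · simp
  obtain rfl | hn₁ := eq_or_ne n 1
  · simp
  simp [hn₀, hn₁]

/-- The polynomial in `1/N` whose value is the coefficient `doubleSeriesCoeff C N p`. -/
def doubleSeriesPoly (C : ℤ → ℤ → ℝ) (p : ℕ) : ℝ[X] :=
  ∑ j ∈ range (p + 1), monomial j (C j ((p : ℤ) - j))

theorem doubleSeriesCoeff_eq_eval (C : ℤ → ℤ → ℝ) (N p : ℕ) :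
    doubleSeriesCoeff C N p = (doubleSeriesPoly C p).eval (N : ℝ)⁻¹ := by
  simp only [doubleSeriesCoeff, doubleSeriesPoly, eval_finsetSum, eval_monomial, inv_pow,
    div_eq_mul_inv]

theorem coeff_doubleSeriesPoly (C : ℤ → ℤ → ℝ) (n j : ℕ) :
    (doubleSeriesPoly C (n + j)).coeff j = C j n := by
  simp only [doubleSeriesPoly, finsetSum_coeff, coeff_monomial]
  rw [sum_ite_eq', if_pos (mem_range.2 (by omega)), Nat.cast_add, add_sub_cancel_right]

theorem doubleSeriesPoly_genusCoeff (p : ℕ) : doubleSeriesPoly genusCoeff p = momentPoly p := by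
  rw [(momentPoly p).as_sum_range' _ (Nat.lt_succ_of_le (natDegree_momentPoly_le p))]
  simp only [doubleSeriesPoly, genusCoeff_sub, intMomentPoly_natCast, intCoeff_natCast]

theorem isFractionalGenusExpansion_genusCoeff : IsFractionalGenusExpansion genusCoeff := by
  refine ⟨fun j n => genusCoeff_of_neg, fun N hN δ hδ P => ?_⟩
  have hcoeff (p : ℕ) : (doubleSeriesCoeff genusCoeff N p : ℂ) =
      (N : ℂ)⁻¹ ^ (p + 1) * wishartMoment (N : ℂ) (N + 1) p := by
    rw [doubleSeriesCoeff_eq_eval, doubleSeriesPoly_genusCoeff,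
      ← aeval_inv_momentPoly (Nat.cast_ne_zero.2 (Nat.one_le_iff_ne_zero.1 hN))]
    simpa using (aeval_algebraMap_apply_eq_algebraMap_eval (A := ℂ) (N : ℝ)⁻¹ (momentPoly p)).symm
  simp only [hcoeff]
  exact isBigO_W₁_sub_sum hN hδ P

end GenusCoefficients

section Uniqueness

open Polynomial Bornology

theorem eq_zero_of_div_pow_isBigO {𝕜 : Type*} [NormedField 𝕜] {l : Filter 𝕜} [l.NeBot]
    (hl : l ≤ cobounded 𝕜) {a : 𝕜} {n : ℕ}
    (h : (fun x => a / x ^ n) =O[l] fun x => 1 / x ^ (n + 1)) : a = 0 := by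
  have hne : ∀ᶠ x in l, x ≠ 0 := hl (eventually_ne_cobounded 0)
  have hconst : (fun _ => a) =O[l] fun x => x⁻¹ := by
    refine (h.mul (isBigO_refl (fun x : 𝕜 => x ^ n) l)).congr' ?_ ?_
    · filter_upwards [hne] with x hx
      exact div_mul_cancel₀ a (pow_ne_zero n hx)
    · filter_upwards [hne] with x hx
      field_simp
      ring
  exact tendsto_nhds_unique tendsto_const_nhds
    (hconst.trans_tendsto (Filter.tendsto_inv₀_cobounded.mono_left hl))

theorem eq_of_isBigO_sub_sum_div_pow {𝕜 : Type*} [NormedField 𝕜] {l : Filter 𝕜} [l.NeBot]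
    (hl : l ≤ cobounded 𝕜) {f : 𝕜 → 𝕜} {a c : ℕ → 𝕜}
    (ha : ∀ P, (fun x => f x - ∑ p ∈ range P, a p / x ^ (p + 1)) =O[l] fun x => 1 / x ^ (P + 1))
    (hc : ∀ P, (fun x => f x - ∑ p ∈ range P, c p / x ^ (p + 1)) =O[l] fun x => 1 / x ^ (P + 1)) :
    a = c := by
  ext P
  induction P using Nat.strong_induction_on with
  | _ P ih =>
    refine sub_eq_zero.1 (eq_zero_of_div_pow_isBigO (n := P + 1) hl ?_)
    refine ((hc (P + 1)).sub (ha (P + 1))).congr_left fun x => ?_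
    rw [sum_range_succ, sum_range_succ,
      sum_congr rfl fun p hp => by rw [← ih p (mem_range.1 hp)]]
    ring

theorem neBot_cobounded_inf_sector {δ : ℝ} (hδ : δ ≤ 1) :
    (cobounded ℂ ⊓ 𝓟 (sector δ)).NeBot := by
  have h : Filter.Tendsto (fun s : ℝ => -(s : ℂ)) Filter.atTop (cobounded ℂ ⊓ 𝓟 (sector δ)) := by
    refine Filter.tendsto_inf.2 ⟨?_, Filter.tendsto_principal.2 ?_⟩
    · rw [← tendsto_norm_atTop_iff_cobounded]
      simpa using Filter.tendsto_abs_atTop_atTop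
    · filter_upwards [Filter.eventually_ge_atTop 0] with s hs t ht
      rw [show -(s : ℂ) - t = -((s + t : ℝ) : ℂ) by push_cast; ring, norm_neg, norm_neg,
        Complex.norm_of_nonneg hs, Complex.norm_of_nonneg (add_nonneg hs ht)]
      nlinarith
  exact h.neBot

theorem eq_of_forall_eval_inv_natCast {q q' : ℝ[X]}
    (h : ∀ N : ℕ, 1 ≤ N → q.eval (N : ℝ)⁻¹ = q'.eval (N : ℝ)⁻¹) : q = q' := by
  have hinj : Function.Injective fun N : ℕ => ((N + 1 : ℕ) : ℝ)⁻¹ := fun N N' hN =>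
    Nat.succ_injective (Nat.cast_injective (inv_injective hN))
  refine eq_of_infinite_eval_eq _ _ ((Set.infinite_range_of_injective hinj).mono ?_)
  rintro _ ⟨N, rfl⟩
  exact h (N + 1) (Nat.succ_pos N)

theorem IsFractionalGenusExpansion.doubleSeriesPoly_eq {C C' : ℤ → ℤ → ℝ}
    (hC : IsFractionalGenusExpansion C) (hC' : IsFractionalGenusExpansion C') (p : ℕ) :
    doubleSeriesPoly C p = doubleSeriesPoly C' p := by
  have := neBot_cobounded_inf_sector le_rfl
  refine eq_of_forall_eval_inv_natCast fun N hN => ?_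
  rw [← doubleSeriesCoeff_eq_eval, ← doubleSeriesCoeff_eq_eval]
  exact Complex.ofReal_injective (congrFun (eq_of_isBigO_sub_sum_div_pow inf_le_left
    (hC.2 N hN 1 one_pos) (hC'.2 N hN 1 one_pos)) p)

theorem IsFractionalGenusExpansion.unique {C C' : ℤ → ℤ → ℝ}
    (hC : IsFractionalGenusExpansion C) (hC' : IsFractionalGenusExpansion C') : C = C' := by
  ext j n
  obtain hjn | ⟨hj, hn⟩ : (j < 0 ∨ n < 0) ∨ 0 ≤ j ∧ 0 ≤ n := by omega
  · rw [hC.1 j n hjn, hC'.1 j n hjn]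
  lift j to ℕ using hj
  lift n to ℕ using hn
  rw [← coeff_doubleSeriesPoly C, ← coeff_doubleSeriesPoly C', hC.doubleSeriesPoly_eq hC']

end Uniqueness

end GenLaguerre

end

theorem mainTheorem9 :
    (∃! C : ℤ → ℤ → ℝ, GenLaguerre.IsFractionalGenusExpansion C) ∧
    ∀ C : ℤ → ℤ → ℝ, GenLaguerre.IsFractionalGenusExpansion C →
      ∀ j n : ℤ,
        ((n : ℝ) + 1) * (2 * C j (n - j) + C (j - 1) (n - j + 1))
          - 4 * (2 * (n : ℝ) - 1) * (C j (n - j - 1) + C (j - 1) (n - j))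
          - ((n : ℝ) - 1) * ((n : ℝ) - 2) * ((n : ℝ) - 3) *
              (2 * C (j - 2) (n - j) + C (j - 3) (n - j + 1))
          - ((n : ℝ) + 1) * ((n : ℝ) - 1) * C (j - 2) (n - j + 1)
          + ((n : ℝ) - 1) * ((n : ℝ) - 2) * ((n : ℝ) - 3) ^ 2 * C (j - 4) (n - j + 1)
        = 2 * (if j = 0 ∧ n = 0 then 1 else 0) + (if j = 1 ∧ n = 0 then 1 else 0)
          + 2 * (if j = 1 ∧ n = 1 then 1 else 0) + 2 * (if j = 2 ∧ n = 1 then 1 else 0) := by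
  have hgenus := GenLaguerre.isFractionalGenusExpansion_genusCoeff
  refine ⟨⟨GenLaguerre.genusCoeff, hgenus, fun C hC => hC.unique hgenus⟩, fun C hC j n => ?_⟩
  obtain rfl := hC.unique hgenus
  exact GenLaguerre.genusCoeff_recurrence j n
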